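/- Let $n\ge 2$, $a<b$ and $0<T<\infty$, and let $(M_t)_{0\le t<T}$ be an axially symmetric solution of the volume preserving mean curvature flow between the planes $x_1=a$ and $x_1=b$ in $\mathbb{R}^{n+1}$. That is, $M_t$ is the hypersurface generated by rotating the graph of a positive function $\rho(\cdot,t):[a,b]\to\mathbb{R}$ about the $x_1$-axis, with $\partial_{x_1}\rho(a,t)=\partial_{x_1}\rho(b,t)=0$; $\rho(\cdot,t)$ is smooth on $[a,b]$ for every $t\in[0,T)$, $\rho$ is smooth on $[a,b]\times(0,T)$, and $\rho,\partial_{x_1}\rho,\partial_{x_1}^2\rho$ are continuous on $[a,b]\times[0,T)$; and the position vector $\mathbf{x}(\cdot,t):M_0\to\mathbb{R}^{n+1}$, with $\mathbf{x}(M_0,t)=M_t$ and $\mathbf{x}(l,0)=l$, is continuous in $t\in[0,T)$ and satisfies $$\frac{d}{dt}\mathbf{x}=-(H-h)\,\nu ,\qquad h(t)=\frac{\int_{M_t}H\,dg_t}{\int_{M_t}dg_t},\qquad 0<t<T,$$ where $\nu$ is the unit normal of $M_t$ pointing away from the axis, $A$ is the second fundamental form of $M_t$ with respect to $\nu$, $A(X,Y)=\langle\overline\nabla_X\nu,Y\rangle$,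 $H$ is its trace, and $g_t$ is the induced metric. Write $y$ for the height, i.e. the distance to the $x_1$-axis. Then: 1. For every $\epsilon>0$ and all subsets $S_t\subset M_t$ ($0\le t<T$) with $y\ge\epsilon$ on $S=\bigcup_{t<T}S_t$, the norm $|A|$ of the second fundamental form is bounded on $S$: there is a constant $C$ with $|A|\le C$ on $S_t$ for all $t\in[0,T)$. 2. Consequently singularities can form at time $T$ only on the axis of rotation: if $t_j\in[0,T)$, $t_j\to T$, $z_j\in M_{t_j}$, $z_j\to p\in\mathbb{R}^{n+1}$ and $|A|(z_j,t_j)\to\infty$, then $p$ lies on the $x_1$-axis. -/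

import Mathlib

open Set Filter Topology MeasureTheory

open scoped ContDiff

noncomputable section

namespace AxialVPMCF

/-- The Euclidean space of dimension `n + 1`; the coordinate with index `0` is called `x₁`, so that
the axis of rotation is the line spanned by `EuclideanSpace.single 0 1`. -/
abbrev Amb (n : ℕ) : Type := EuclideanSpace ℝ (Fin (n + 1))

/-- The unit vector `i₁` that spans the axis of rotation. -/
def axisDir (n : ℕ) : Amb n := EuclideanSpace.single 0 1

/-- `x̂ = x - ⟨x, i₁⟩ i₁`. -/
def hat {n : ℕ} (x : Amb n) : Amb n := x - inner ℝ x (axisDir n) • axisDir n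

/-- `ω = x̂ / |x̂|`. -/
def radialDir {n : ℕ} (x : Amb n) : Amb n := ‖hat x‖⁻¹ • hat x

/-- The height `y = ⟨x, ω⟩`, which is the distance `|x̂|` to the axis of rotation. -/
def height {n : ℕ} (x : Amb n) : ℝ := inner ℝ x (radialDir x)

/-- The axis of rotation. -/
def rotationAxis (n : ℕ) : Set (Amb n) := {x | hat x = 0}

/-- The closed region between the planes `x₁ = a` and `x₁ = b`. -/
def slab (n : ℕ) (a b : ℝ) : Set (Amb n) := {x | x 0 ∈ Icc a b}

/-- The hypersurface generated by rotating the graph of `r : [a, b] → ℝ` about the axis. -/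
def revSurface (n : ℕ) (a b : ℝ) (r : ℝ → ℝ) : Set (Amb n) :=
  {x | x ∈ slab n a b ∧ height x = r (x 0)}

/-- The derivative of the radius function, one-sided at the end points. -/
def slope (a b : ℝ) (r : ℝ → ℝ) (s : ℝ) : ℝ := derivWithin r (Icc a b) s

/-- The outer unit normal `(ω - r' i₁) / √(1 + r'²)` of the hypersurface generated by `r`, extended
to the points of the slab off the axis, constantly in the radial directions. -/
def normal {n : ℕ} (a b : ℝ) (r : ℝ → ℝ) (x : Amb n) : Amb n :=
  (√(1 + slope a b r (x 0) ^ 2))⁻¹ • (radialDir x - slope a b r (x 0) • axisDir n)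

/-- The tangent space of the hypersurface at `x`. -/
abbrev tangent {n : ℕ} (a b : ℝ) (r : ℝ → ℝ) (x : Amb n) : Submodule ℝ (Amb n) :=
  (ℝ ∙ normal a b r x)ᗮ

/-- The Weingarten map `X ↦ ∇_X ν` of the tangent space at `x`, where `∇` is the flat connection;
the second fundamental form is `A(X, Y) = ⟨∇_X ν, Y⟩`. -/
def weingarten {n : ℕ} (a b : ℝ) (r : ℝ → ℝ) (x : Amb n) :
    tangent a b r x →ₗ[ℝ] tangent a b r x :=
  ((tangent a b r x).orthogonalProjectionOnto : Amb n →ₗ[ℝ] tangent a b r x) ∘ₗ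
    (fderivWithin ℝ (normal a b r) (slab n a b) x : Amb n →ₗ[ℝ] Amb n) ∘ₗ
      (tangent a b r x).subtype

/-- The mean curvature `H`, the trace of the second fundamental form. -/
def meanCurv {n : ℕ} (a b : ℝ) (r : ℝ → ℝ) (x : Amb n) : ℝ :=
  LinearMap.trace ℝ _ (weingarten a b r x)

/-- The norm `|A|` of the second fundamental form: `|A|² = ∑ A(eᵢ, eⱼ)²` over an orthonormal basis
of the tangent space. -/
def normA {n : ℕ} (a b : ℝ) (r : ℝ → ℝ) (x : Amb n) : ℝ :=
  √(LinearMap.trace ℝ _ (LinearMap.adjoint (weingarten a b r x) ∘ₗ weingarten a b r x))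

/-- The point `(s, r(s) θ)` of the hypersurface, where `θ` is a unit vector of `ℝⁿ`. -/
def revPoint {n : ℕ} (r : ℝ → ℝ) (s : ℝ)
    (θ : Metric.sphere (0 : EuclideanSpace ℝ (Fin n)) 1) : Amb n :=
  WithLp.toLp 2 (Fin.cons s (fun i => r s * (θ : EuclideanSpace ℝ (Fin n)) i))

/-- The integral `∫_M f dg` over the hypersurface `M` generated by `r`. In the coordinates `(s, θ)`
the induced metric is `g = (1 + r'²) ds² + r² g_{S^{n-1}}`, so that its Riemannian measure is
`dg = r^{n-1} √(1 + r'²) ds dσ(θ)`, with `σ` the surface measure of the unit sphere. -/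
def surfIntegral (n : ℕ) (a b : ℝ) (r : ℝ → ℝ) (f : Amb n → ℝ) : ℝ :=
  ∫ s in a..b, ∫ θ, f (revPoint r s θ) * (r s ^ (n - 1) * √(1 + slope a b r s ^ 2))
    ∂((volume : Measure (EuclideanSpace ℝ (Fin n))).toSphere)

/-- The average `h` of the mean curvature. -/
def avgMeanCurv (n : ℕ) (a b : ℝ) (r : ℝ → ℝ) : ℝ :=
  surfIntegral n a b r (meanCurv a b r) / surfIntegral n a b r (fun _ => 1)

/-- `ρ` is the radius function, and `x` the position vector, of an axially symmetric solution
`M_t = revSurface n a b (ρ t)`, `0 ≤ t < T`, of the volume preserving mean curvature flow between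
the planes `x₁ = a` and `x₁ = b`, which it meets at right angles. The parameter manifold is the
initial hypersurface `M_0`, and the initial immersion is its inclusion.

Joint smoothness is asked for positive times; at time `0` only `ρ` and its first two derivatives in
space have to be continuous, because the initial radius function is subject to no compatibility
conditions of higher order at `a` and `b`. -/
structure IsFlow (n : ℕ) (a b T : ℝ) (ρ : ℝ → ℝ → ℝ) (x : Amb n → ℝ → Amb n) : Prop where
  smooth_space : ∀ t ∈ Ico 0 T, ContDiffOn ℝ ∞ (ρ t) (Icc a b)
  smooth : ContDiffOn ℝ ∞ (fun z : ℝ × ℝ => ρ z.1 z.2) (Ioo 0 T ×ˢ Icc a b)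
  continuous_initial : ∀ j ≤ 2, ContinuousOn
    (fun z : ℝ × ℝ => iteratedDerivWithin j (ρ z.1) (Icc a b) z.2) (Ico 0 T ×ˢ Icc a b)
  pos : ∀ t ∈ Ico 0 T, ∀ s ∈ Icc a b, 0 < ρ t s
  neumann : ∀ t ∈ Ico 0 T, slope a b (ρ t) a = 0 ∧ slope a b (ρ t) b = 0
  position_initial : ∀ l ∈ revSurface n a b (ρ 0), x l 0 = l
  position_image : ∀ t ∈ Ico 0 T,
    (fun l => x l t) '' revSurface n a b (ρ 0) = revSurface n a b (ρ t)
  position_continuous : ∀ l ∈ revSurface n a b (ρ 0), ContinuousOn (x l) (Ico 0 T)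
  evolution : ∀ l ∈ revSurface n a b (ρ 0), ∀ t ∈ Ioo 0 T,
    HasDerivAt (x l)
      (-(meanCurv a b (ρ t) (x l t) - avgMeanCurv n a b (ρ t)) • normal a b (ρ t) (x l t)) t

/-- A singularity forms at the point `p` at time `T`: near `p` the second fundamental form of `M_t`
is unbounded as `t → T`. -/
def IsSingularPoint (n : ℕ) (a b T : ℝ) (ρ : ℝ → ℝ → ℝ) (p : Amb n) : Prop :=
  ∃ (τ : ℕ → ℝ) (z : ℕ → Amb n), (∀ j, τ j ∈ Ico 0 T) ∧ Tendsto τ atTop (𝓝 T) ∧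
    (∀ j, z j ∈ revSurface n a b (ρ (τ j))) ∧ Tendsto z atTop (𝓝 p) ∧
    Tendsto (fun j => normA a b (ρ (τ j)) (z j)) atTop atTop

end AxialVPMCF

end

/-! Write v = √(1 + ρ'²). Following the height of a material point turns the flow into ρ_t = ρ''/v²
- (n-1)/ρ + h v with Neumann conditions (`hasDerivAt_radius`). The principal curvatures are -ρ''/v³,
once, and 1/(ρ v), n - 1 times. Where ρ ≥ ε the latter is at most 1/ε, so the theorem reduces to a
bound for Q = ρ''/v² on {ρ ≥ ε}.

The nonlocal term h is not estimated pointwise, but in L² with respect to time. The volume ∫ ρⁿ is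
constant and the area ∫ ρ^{n-1} v decreases at the rate D = ∫ ρ^{n-1} ρ_t²/v (`volume_const`,
`hasDerivAt_area`); together they bound ρ. Testing the equation with ρⁿ, and integrating Q = (arctan
ρ')' by parts, bounds h² by a multiple of D plus a constant (`sq_avg_le`). As D is minus the
derivative of the area, there is a bounded function B of time with B' ≥ h² + 1 (`exists_barrier`).
It compensates the terms containing h in two applications of the maximum principle.

Gradient: ρ v - B has no maximum after the starting time, so ρ v is bounded, and so is v where ρ ≥ ε
(`exists_gradient_bound`).

Curvature: with v² ≤ κ on {ρ ≥ ε}, take G = Q (ρ - ε)/(2κ - ρ'²). The factor ρ - ε localizes, and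
the denominator contributes the good term -2 v⁴ Q² G. For large |G| it absorbs all reaction terms up
to a multiple of h² G², which the weight in G² exp(-cB) cancels (`curvature_reaction_le`,
`exists_cutoff_curvature_bound`).

All this takes place on [T/2, T); on [0, T/2] the continuity of ρ'' up to the initial time suffices.
Finally, points converging to a point off the axis keep a positive distance from the axis, so |A|
stays bounded along them. -/

namespace AxialVPMCF

/-! ### Height and radial direction off the axis -/

section Euclidean

variable {n : ℕ}

theorem inner_axisDir (x : Amb n) : inner ℝ x (axisDir n) = x 0 := by
  simp [axisDir, EuclideanSpace.inner_single_right]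

theorem inner_axisDir_left (x : Amb n) : inner ℝ (axisDir n) x = x 0 := by
  rw [real_inner_comm, inner_axisDir]

theorem axisDir_zero : axisDir n 0 = 1 := by simp [axisDir]

theorem inner_axisDir_self : inner ℝ (axisDir n) (axisDir n) = 1 := by
  rw [inner_axisDir, axisDir_zero]

theorem hat_eq (x : Amb n) : hat x = x - x 0 • axisDir n := by
  rw [hat, inner_axisDir]

theorem inner_hat_axisDir (x : Amb n) : inner ℝ (hat x) (axisDir n) = 0 := by
  rw [hat_eq, inner_sub_left, real_inner_smul_left, inner_axisDir_self, inner_axisDir]; ring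

theorem inner_hat_left (x z : Amb n) : inner ℝ (hat x) (hat z) = inner ℝ (hat x) z := by
  rw [hat_eq z, inner_sub_right, real_inner_smul_right, inner_hat_axisDir]; ring

theorem inner_hat_self (x : Amb n) : inner ℝ x (hat x) = ‖hat x‖ ^ 2 := by
  rw [← real_inner_self_eq_norm_sq, inner_hat_left, real_inner_comm]

theorem height_eq_norm_hat (x : Amb n) : height x = ‖hat x‖ := by
  rw [height, radialDir, real_inner_smul_right, inner_hat_self]
  by_cases h : ‖hat x‖ = 0
  · simp [h]
  · field_simp

/-- The orthogonal projection off the axis as a continuous linear map. -/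
noncomputable def hatCLM (n : ℕ) : Amb n →L[ℝ] Amb n :=
  ContinuousLinearMap.id ℝ _ - (EuclideanSpace.proj (0 : Fin (n + 1))).smulRight (axisDir n)

theorem hatCLM_apply (x : Amb n) : hatCLM n x = hat x := by
  simp [hatCLM, hat_eq]

theorem continuous_height : Continuous (height : Amb n → ℝ) := by
  have : (height : Amb n → ℝ) = fun x => ‖hatCLM n x‖ := by
    funext x; rw [height_eq_norm_hat, hatCLM_apply]
  rw [this]; fun_prop

theorem inner_radialDir_axisDir (x : Amb n) : inner ℝ (radialDir x) (axisDir n) = 0 := by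
  rw [radialDir, real_inner_smul_left, inner_hat_axisDir, mul_zero]

theorem radialDir_zero (x : Amb n) : radialDir x 0 = 0 := by
  rw [← inner_axisDir, inner_radialDir_axisDir]

theorem inner_radialDir_self {x : Amb n} (hx : 0 < height x) :
    inner ℝ (radialDir x) (radialDir x) = 1 := by
  rw [height_eq_norm_hat] at hx
  rw [radialDir, real_inner_smul_left, real_inner_smul_right, real_inner_self_eq_norm_sq]
  field_simp

theorem hasFDerivAt_height {x : Amb n} (hx : 0 < height x) :
    HasFDerivAt height (innerSL ℝ (radialDir x)) x := by
  rw [height_eq_norm_hat] at hx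
  have h0 : hatCLM n x ≠ 0 := by rw [hatCLM_apply]; exact norm_pos_iff.1 hx
  have h := ((hatCLM n).hasFDerivAt (x := x)).norm_sq.sqrt (by positivity)
  have e : (fun z => √(‖hatCLM n z‖ ^ 2)) = height := by
    funext z; rw [Real.sqrt_sq (norm_nonneg _), height_eq_norm_hat, hatCLM_apply]
  rw [e] at h
  refine h.congr_fderiv ?_
  ext1 z
  rw [Real.sqrt_sq (norm_nonneg _)]
  simp only [hatCLM_apply, radialDir, innerSL_apply_apply,
    smul_apply, ContinuousLinearMap.comp_apply, smul_eq_mul,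
    real_inner_smul_left, inner_hat_left, nsmul_eq_mul]
  push_cast
  field_simp

theorem hasFDerivAt_radialDir {x : Amb n} (hx : 0 < height x) :
    HasFDerivAt radialDir ((height x)⁻¹ • (hatCLM n -
      (innerSL ℝ (radialDir x)).smulRight (radialDir x))) x := by
  have e' : (radialDir : Amb n → Amb n) = ((Inv.inv ∘ height : Amb n → ℝ) • (hatCLM n : Amb n → Amb n)) := by
    funext z; rw [Pi.smul_apply', Function.comp_apply, height_eq_norm_hat, hatCLM_apply, radialDir]
  have h := ((hasDerivAt_inv hx.ne').comp_hasFDerivAt x (hasFDerivAt_height hx)).smul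
    ((hatCLM n).hasFDerivAt (x := x))
  rw [← e'] at h
  refine h.congr_fderiv ?_
  ext1 z
  have hr : hat x = height x • radialDir x := by
    rw [height_eq_norm_hat] at hx ⊢
    rw [radialDir, smul_smul, mul_inv_cancel₀ hx.ne', one_smul]
  simp only [hatCLM_apply, hr, smul_apply,
    sub_apply, ContinuousLinearMap.smulRight_apply,
    add_apply, innerSL_apply_apply, smul_sub, smul_smul, smul_eq_mul]
  rw [sub_eq_add_neg, ← neg_smul]
  congr 2
  field_simp

end Euclidean

/-! ### Curvatures of a hypersurface of revolution -/

section Weingarten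

variable {n : ℕ} {a b : ℝ} {r : ℝ → ℝ} {x : Amb n}

/-- The slab is convex with nonempty interior, so `fderivWithin` in `weingarten` is a well
determined derivative even on the two bounding planes. -/
theorem uniqueDiffWithinAt_slab (hab : a < b) (hx : x ∈ slab n a b) :
    UniqueDiffWithinAt ℝ (slab n a b) x := by
  have hc : Convex ℝ (slab n a b) :=
    (convex_Icc a b).is_linear_preimage (EuclideanSpace.proj (𝕜 := ℝ) (0 : Fin (n + 1))).isLinear
  refine uniqueDiffWithinAt_convex hc ⟨((a + b) / 2) • axisDir n, ?_⟩ (subset_closure hx)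
  have : {z : Amb n | z 0 ∈ Ioo a b} ⊆ interior (slab n a b) := by
    refine interior_maximal (fun z hz => Ioo_subset_Icc_self hz) ?_
    exact isOpen_Ioo.preimage (EuclideanSpace.proj (𝕜 := ℝ) (0 : Fin (n + 1))).continuous
  apply this
  simp only [mem_ofPred_eq, PiLp.smul_apply, axisDir_zero, smul_eq_mul, mul_one]
  constructor <;> linarith

theorem inner_normal (z : Amb n) : inner ℝ (normal a b r x) z =
    (√(1 + slope a b r (x 0) ^ 2))⁻¹ * (inner ℝ (radialDir x) z - slope a b r (x 0) * z 0) := by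
  rw [normal, real_inner_smul_left, inner_sub_left, real_inner_smul_left, inner_axisDir_left]

theorem mem_tangent_iff {z : Amb n} :
    z ∈ tangent a b r x ↔ inner ℝ (radialDir x) z = slope a b r (x 0) * z 0 := by
  rw [tangent, Submodule.mem_orthogonal_singleton_iff_inner_right, inner_normal]
  have : 0 < √(1 + slope a b r (x 0) ^ 2) := by positivity
  constructor
  · intro h
    have := (mul_eq_zero.1 h).resolve_left (by positivity)
    linarith
  · intro h; rw [h]; ring

/-- On tangent vectors the derivative is the rotational curvature p = 1/(y v) times the identity,
corrected in the profile direction i₁ + wω. That vector has first coordinate 1 and is sent to -q/v³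
times itself. -/
theorem hasFDerivWithinAt_normal {q : ℝ} (hx : 0 < height x)
    (hq : HasDerivWithinAt (slope a b r) q (Icc a b) (x 0)) :
    ∃ L : Amb n →L[ℝ] Amb n, HasFDerivWithinAt (normal a b r) L (slab n a b) x ∧
      ∀ z ∈ tangent a b r x, L z =
        (1 / (height x * √(1 + slope a b r (x 0) ^ 2))) • z -
        (z 0 * (1 / (height x * √(1 + slope a b r (x 0) ^ 2)) +
          q / √(1 + slope a b r (x 0) ^ 2) ^ 3)) •
          (axisDir n + slope a b r (x 0) • radialDir x) := by
  set w := slope a b r (x 0) with hw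
  have hV : 0 < 1 + w ^ 2 := by positivity
  have hv : 0 < √(1 + w ^ 2) := by positivity
  have hv2 : √(1 + w ^ 2) ^ 2 = 1 + w ^ 2 := Real.sq_sqrt hV.le
  have hs : HasDerivWithinAt (fun s => √(1 + slope a b r s ^ 2)) (w * q / √(1 + w ^ 2))
      (Icc a b) (x 0) := by
    refine (((hq.fun_pow 2).const_add 1).sqrt (hw ▸ hV.ne')).congr_deriv ?_
    rw [← hw]
    field_simp
    norm_num
    ring
  have hc : HasDerivWithinAt (fun s => (√(1 + slope a b r s ^ 2))⁻¹) (-(w * q / √(1 + w ^ 2) ^ 3))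
      (Icc a b) (x 0) := by
    refine (hs.fun_inv (hw ▸ hv.ne')).congr_deriv ?_
    rw [← hw]
    field_simp
  have hP : MapsTo (EuclideanSpace.proj (𝕜 := ℝ) (0 : Fin (n + 1))) (slab n a b) (Icc a b) :=
    fun z hz => hz
  have hcx := hc.hasFDerivWithinAt.comp x
    (EuclideanSpace.proj (𝕜 := ℝ) (0 : Fin (n + 1))).hasFDerivWithinAt hP
  have hsx := hq.hasFDerivWithinAt.comp x
    (EuclideanSpace.proj (𝕜 := ℝ) (0 : Fin (n + 1))).hasFDerivWithinAt hP
  have h := hcx.smul ((hasFDerivAt_radialDir hx).hasFDerivWithinAt.sub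
    (hsx.smul_const (axisDir n)))
  refine ⟨_, h, fun z hz => ?_⟩
  rw [mem_tangent_iff, ← hw] at hz
  have hp : (EuclideanSpace.proj (𝕜 := ℝ) (0 : Fin (n + 1))) x = x 0 := rfl
  have hp' : (EuclideanSpace.proj (𝕜 := ℝ) (0 : Fin (n + 1))) z = z 0 := rfl
  simp only [smul_apply, add_apply, sub_apply,
    ContinuousLinearMap.smulRight_apply, innerSL_apply_apply, hp, hp',
    ContinuousLinearMap.comp_apply, Function.comp_apply, hatCLM_apply,
    hz, hat_eq, ← hw, ContinuousLinearMap.toSpanSingleton_apply, Pi.sub_apply, smul_eq_mul]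
  match_scalars
  · field_simp
  · field_simp
    rw [hv2]
    ring
  · field_simp
    ring

theorem finrank_tangent (hx : 0 < height x) : Module.finrank ℝ (tangent a b r x) = n := by
  have : Fact (Module.finrank ℝ (Amb n) = n + 1) := ⟨by simp⟩
  refine Submodule.finrank_orthogonal_span_singleton fun h0 => ?_
  have h1 := inner_normal (a := a) (b := b) (r := r) (x := x) (radialDir x)
  rw [h0, inner_zero_left, inner_radialDir_self hx, radialDir_zero] at h1
  have h2 : 0 < √(1 + slope a b r (x 0) ^ 2) := by positivity
  simp at h1
  exact h2.ne h1

/-- The Weingarten map is a multiple of the identity up to a rank one map. -/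
theorem weingarten_eq {q : ℝ} (hab : a < b) (hxs : x ∈ slab n a b) (hx : 0 < height x)
    (hq : HasDerivWithinAt (slope a b r) q (Icc a b) (x 0)) :
    ∃ e : tangent a b r x, ‖e‖ ^ 2 = 1 + slope a b r (x 0) ^ 2 ∧
      weingarten a b r x = (1 / (height x * √(1 + slope a b r (x 0) ^ 2))) • LinearMap.id -
        ((1 / (height x * √(1 + slope a b r (x 0) ^ 2)) +
          q / √(1 + slope a b r (x 0) ^ 2) ^ 3) / (1 + slope a b r (x 0) ^ 2)) •
          (InnerProductSpace.rankOne ℝ e e : tangent a b r x →ₗ[ℝ] tangent a b r x) := by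
  obtain ⟨L, hL, hLz⟩ := hasFDerivWithinAt_normal hx hq
  set w := slope a b r (x 0) with hw
  have hV : 0 < 1 + w ^ 2 := by positivity
  have he : axisDir n + w • radialDir x ∈ tangent a b r x := by
    rw [mem_tangent_iff, ← hw, inner_add_right, real_inner_smul_right, inner_radialDir_axisDir,
      inner_radialDir_self hx, PiLp.add_apply, PiLp.smul_apply, radialDir_zero, axisDir_zero]
    simp
  refine ⟨⟨_, he⟩, ?_, ?_⟩
  · rw [← real_inner_self_eq_norm_sq]
    simp only [Submodule.coe_inner]
    rw [inner_add_left, inner_add_right, inner_add_right, real_inner_smul_left,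
      real_inner_smul_left, real_inner_smul_right, real_inner_smul_right, inner_axisDir_self,
      inner_radialDir_self hx, inner_radialDir_axisDir, inner_axisDir_left, radialDir_zero]
    ring
  · ext1 z
    have hz := hLz z z.2
    have hf : fderivWithin ℝ (normal a b r) (slab n a b) x = L :=
      hL.fderivWithin (uniqueDiffWithinAt_slab hab hxs)
    have hi : inner ℝ (axisDir n + w • radialDir x) (z : Amb n) =
        (1 + w ^ 2) * (z : Amb n) 0 := by
      rw [inner_add_left, real_inner_smul_left, inner_axisDir_left, mem_tangent_iff.1 z.2, ← hw]
      ring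
    have hz' : fderivWithin ℝ (normal a b r) (slab n a b) x z =
        (((1 / (height x * √(1 + w ^ 2))) • z - ((z : Amb n) 0 * (1 / (height x * √(1 + w ^ 2)) +
          q / √(1 + w ^ 2) ^ 3)) • ⟨_, he⟩ : tangent a b r x) : Amb n) := by
      rw [hf, hz]; rfl
    have h1 : weingarten a b r x z = (1 / (height x * √(1 + w ^ 2))) • z -
        ((z : Amb n) 0 * (1 / (height x * √(1 + w ^ 2)) +
          q / √(1 + w ^ 2) ^ 3)) • ⟨_, he⟩ := by
      change (tangent a b r x).orthogonalProjectionOnto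
        (fderivWithin ℝ (normal a b r) (slab n a b) x z) = _
      rw [hz']
      exact Submodule.orthogonalProjectionOnto_mem_subspace_eq_self _
    rw [h1]
    simp only [LinearMap.sub_apply, LinearMap.smul_apply, LinearMap.id_apply,
      ContinuousLinearMap.coe_coe, InnerProductSpace.rankOne_apply, Submodule.coe_inner, hi,
      smul_smul]
    congr 2
    field_simp

theorem meanCurv_eq {q : ℝ} (hab : a < b) (hxs : x ∈ slab n a b) (hx : 0 < height x)
    (hq : HasDerivWithinAt (slope a b r) q (Icc a b) (x 0)) :
    meanCurv a b r x = -(q / √(1 + slope a b r (x 0) ^ 2) ^ 3) +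
      (n - 1) * (1 / (height x * √(1 + slope a b r (x 0) ^ 2))) := by
  obtain ⟨e, he, hW⟩ := weingarten_eq hab hxs hx hq
  rw [meanCurv, hW, map_sub, map_smul, map_smul, LinearMap.trace_id, finrank_tangent hx,
    InnerProductSpace.trace_rankOne, real_inner_self_eq_norm_sq, he]
  have hV : 0 < 1 + slope a b r (x 0) ^ 2 := by positivity
  simp only [smul_eq_mul]
  rw [div_mul_cancel₀ _ hV.ne']
  ring

/-- W is self-adjoint, equal to p on the complement of e and to p - β‖e‖² on e; the trace is the sum
of the squared eigenvalues. -/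
theorem trace_adjoint_comp_self {E : Type*} [NormedAddCommGroup E] [InnerProductSpace ℝ E]
    [FiniteDimensional ℝ E] {W : E →ₗ[ℝ] E} {p β : ℝ} {e : E}
    (hW : W = p • LinearMap.id - β • (InnerProductSpace.rankOne ℝ e e : E →ₗ[ℝ] E)) :
    LinearMap.trace ℝ _ (LinearMap.adjoint W ∘ₗ W) =
      (Module.finrank ℝ E - 1) * p ^ 2 + (p - β * ‖e‖ ^ 2) ^ 2 := by
  have hadj : LinearMap.adjoint W = W := by
    symm
    rw [LinearMap.eq_adjoint_iff]
    intro y z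
    rw [hW]
    simp only [LinearMap.sub_apply, LinearMap.smul_apply, LinearMap.id_apply,
      ContinuousLinearMap.coe_coe, InnerProductSpace.rankOne_apply, inner_sub_left,
      inner_sub_right, real_inner_smul_left, real_inner_smul_right, real_inner_comm e y]
    ring
  have hsq : W ∘ₗ W = p ^ 2 • LinearMap.id -
      (β * (2 * p - β * ‖e‖ ^ 2)) • (InnerProductSpace.rankOne ℝ e e : E →ₗ[ℝ] E) := by
    rw [hW]
    ext1 z
    simp only [LinearMap.comp_apply, LinearMap.sub_apply, LinearMap.smul_apply, LinearMap.id_apply,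
      ContinuousLinearMap.coe_coe, InnerProductSpace.rankOne_apply,
      inner_sub_right, real_inner_smul_right, real_inner_self_eq_norm_sq]
    module
  rw [hadj, hsq, map_sub, map_smul, map_smul, LinearMap.trace_id,
    InnerProductSpace.trace_rankOne, real_inner_self_eq_norm_sq]
  simp only [smul_eq_mul]
  ring

theorem normA_eq {q : ℝ} (hab : a < b) (hxs : x ∈ slab n a b) (hx : 0 < height x)
    (hq : HasDerivWithinAt (slope a b r) q (Icc a b) (x 0)) :
    normA a b r x = √((q / √(1 + slope a b r (x 0) ^ 2) ^ 3) ^ 2 +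
      (n - 1) * (1 / (height x * √(1 + slope a b r (x 0) ^ 2))) ^ 2) := by
  obtain ⟨e, he, hW⟩ := weingarten_eq hab hxs hx hq
  have hV : 0 < 1 + slope a b r (x 0) ^ 2 := by positivity
  rw [normA, trace_adjoint_comp_self hW, he, finrank_tangent hx, div_mul_cancel₀ _ hV.ne']
  congr 1
  ring

end Weingarten

/-! ### Integrals of rotationally symmetric functions -/

section RevPoint

variable {n : ℕ} {a b : ℝ} {r : ℝ → ℝ}

theorem revPoint_zero (s : ℝ) (θ : Metric.sphere (0 : EuclideanSpace ℝ (Fin n)) 1) :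
    revPoint r s θ 0 = s := rfl

theorem height_revPoint {s : ℝ} (hs : 0 ≤ r s)
    (θ : Metric.sphere (0 : EuclideanSpace ℝ (Fin n)) 1) : height (revPoint r s θ) = r s := by
  have hθ : ∑ i, (θ : EuclideanSpace ℝ (Fin n)) i ^ 2 = 1 := by
    rw [← EuclideanSpace.real_norm_sq_eq, norm_eq_of_mem_sphere θ, one_pow]
  have h : ‖hat (revPoint r s θ)‖ ^ 2 = r s ^ 2 := by
    have h0 : axisDir n 0 = 1 := axisDir_zero
    have h1 : ∀ i : Fin n, axisDir n i.succ = 0 := fun i => by simp [axisDir]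
    have h2 : ∀ i : Fin n, revPoint r s θ i.succ = r s * (θ : EuclideanSpace ℝ (Fin n)) i :=
      fun i => rfl
    rw [EuclideanSpace.real_norm_sq_eq, Fin.sum_univ_succ]
    simp only [hat_eq, PiLp.sub_apply, PiLp.smul_apply, h0, h1, h2, smul_eq_mul, mul_one, sub_self,
      mul_zero, sub_zero, mul_pow, ← Finset.mul_sum, hθ]
    ring
  rw [height_eq_norm_hat]
  exact (sq_eq_sq₀ (norm_nonneg _) hs).1 h

theorem revPoint_mem {s : ℝ} (hs : s ∈ Icc a b) (hr : 0 ≤ r s)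
    (θ : Metric.sphere (0 : EuclideanSpace ℝ (Fin n)) 1) :
    revPoint r s θ ∈ revSurface n a b r :=
  ⟨hs, height_revPoint hr θ⟩

/-- The integrand is constant on the spheres s = const, so only the total measure of the unit sphere
remains; it cancels in the quotient defining h. -/
theorem surfIntegral_eq {f : Amb n → ℝ} {F : ℝ → ℝ} (hab : a ≤ b)
    (hF : ∀ s ∈ Icc a b, ∀ θ, f (revPoint r s θ) = F s) :
    surfIntegral n a b r f =
      ((volume : Measure (EuclideanSpace ℝ (Fin n))).toSphere.real univ) *
        ∫ s in a..b, F s * (r s ^ (n - 1) * √(1 + slope a b r s ^ 2)) := by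
  rw [surfIntegral, ← intervalIntegral.integral_const_mul]
  refine intervalIntegral.integral_congr fun s hs => ?_
  rw [uIcc_of_le hab] at hs
  simp only [hF s hs, integral_const, smul_eq_mul]

theorem toSphere_real_univ_pos (hn : 2 ≤ n) :
    0 < (volume : Measure (EuclideanSpace ℝ (Fin n))).toSphere.real univ := by
  have : Nonempty (Fin n) := ⟨⟨0, by omega⟩⟩
  rw [measureReal_def, ENNReal.toReal_pos_iff]
  refine ⟨?_, measure_lt_top _ _⟩
  rw [Measure.toSphere_apply_univ]
  have : 0 < volume (Metric.ball (0 : EuclideanSpace ℝ (Fin n)) 1) :=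
    Metric.measure_ball_pos _ _ one_pos
  simp only [finrank_euclideanSpace, Fintype.card_fin]
  refine ENNReal.mul_pos ?_ this.ne'
  simp; omega

end RevPoint

/-! ### Partial derivatives on the space-time domain -/

section Partial

/-- The space-time domain. -/
def dom (a b T : ℝ) : Set (ℝ × ℝ) := Ioo 0 T ×ˢ Icc a b

/-- The partial derivative in the second variable. -/
noncomputable def pderivS (a b T : ℝ) (F : ℝ × ℝ → ℝ) (z : ℝ × ℝ) : ℝ :=
  fderivWithin ℝ F (dom a b T) z (0, 1)

/-- The partial derivative in the first variable. -/
noncomputable def pderivT (a b T : ℝ) (F : ℝ × ℝ → ℝ) (z : ℝ × ℝ) : ℝ :=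
  fderivWithin ℝ F (dom a b T) z (1, 0)

variable {a b T : ℝ} {F : ℝ × ℝ → ℝ}

theorem uniqueDiffOn_dom (hab : a < b) : UniqueDiffOn ℝ (dom a b T) :=
  (uniqueDiffOn_Ioo 0 T).prod (uniqueDiffOn_Icc hab)

theorem contDiffOn_pderivS (hab : a < b) (hF : ContDiffOn ℝ ∞ F (dom a b T)) :
    ContDiffOn ℝ ∞ (pderivS a b T F) (dom a b T) :=
  (hF.fderivWithin (uniqueDiffOn_dom hab) (by simp)).clm_apply contDiffOn_const

theorem contDiffOn_pderivT (hab : a < b) (hF : ContDiffOn ℝ ∞ F (dom a b T)) :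
    ContDiffOn ℝ ∞ (pderivT a b T F) (dom a b T) :=
  (hF.fderivWithin (uniqueDiffOn_dom hab) (by simp)).clm_apply contDiffOn_const

theorem hasFDerivWithinAt_dom (hF : ContDiffOn ℝ ∞ F (dom a b T)) {z : ℝ × ℝ}
    (hz : z ∈ dom a b T) :
    HasFDerivWithinAt F (fderivWithin ℝ F (dom a b T) z) (dom a b T) z :=
  (hF.differentiableOn (by simp) z hz).hasFDerivWithinAt

theorem fderivWithin_dom_apply (z : ℝ × ℝ) (c d : ℝ) :
    fderivWithin ℝ F (dom a b T) z (c, d) = c * pderivT a b T F z + d * pderivS a b T F z := by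
  have : ((c, d) : ℝ × ℝ) = c • (1, 0) + d • (0, 1) := by simp
  rw [this, map_add, map_smul, map_smul]; rfl

theorem hasDerivWithinAt_pderivS (hF : ContDiffOn ℝ ∞ F (dom a b T)) {t s : ℝ}
    (ht : t ∈ Ioo 0 T) (hs : s ∈ Icc a b) :
    HasDerivWithinAt (fun s => F (t, s)) (pderivS a b T F (t, s)) (Icc a b) s := by
  have h : HasDerivWithinAt (fun s : ℝ => (t, s)) ((0, 1) : ℝ × ℝ) (Icc a b) s :=
    ((hasDerivAt_const s t).prodMk (hasDerivAt_id s)).hasDerivWithinAt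
  exact (hasFDerivWithinAt_dom hF (mk_mem_prod ht hs)).comp_hasDerivWithinAt s h
    (fun s' hs' => mk_mem_prod ht hs')

/-- Needed for the first coordinate of a material point, which may run along an end of [a, b]. The
derivative within `dom` still becomes two-sided in time, since the time interval is open. -/
theorem hasDerivAt_comp_curve (hF : ContDiffOn ℝ ∞ F (dom a b T)) {t c : ℝ} {γ : ℝ → ℝ}
    (ht : t ∈ Ioo 0 T) (hγ : HasDerivAt γ c t) (hmem : ∀ τ ∈ Ioo 0 T, γ τ ∈ Icc a b) :
    HasDerivAt (fun τ => F (τ, γ τ)) (pderivT a b T F (t, γ t) + c * pderivS a b T F (t, γ t)) t := by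
  have h : HasDerivWithinAt (fun τ : ℝ => (τ, γ τ)) ((1, c) : ℝ × ℝ) (Ioo 0 T) t :=
    ((hasDerivAt_id t).prodMk hγ).hasDerivWithinAt
  have h2 := (hasFDerivWithinAt_dom hF (mk_mem_prod ht (hmem t ht))).comp_hasDerivWithinAt t h
    (fun τ hτ => mk_mem_prod hτ (hmem τ hτ))
  rw [fderivWithin_dom_apply, one_mul] at h2
  exact h2.hasDerivAt (isOpen_Ioo.mem_nhds ht)

theorem hasDerivAt_pderivT (hF : ContDiffOn ℝ ∞ F (dom a b T)) {t s : ℝ}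
    (ht : t ∈ Ioo 0 T) (hs : s ∈ Icc a b) :
    HasDerivAt (fun t => F (t, s)) (pderivT a b T F (t, s)) t := by
  simpa using hasDerivAt_comp_curve hF ht (hasDerivAt_const t s) (fun _ _ => hs)

/-- Second derivatives within the domain are symmetric also at s = a and s = b, because these points
lie in the closure of the interior. -/
theorem pderivS_pderivT (hab : a < b) (hF : ContDiffOn ℝ ∞ F (dom a b T)) {z : ℝ × ℝ}
    (hz : z ∈ dom a b T) :
    pderivS a b T (pderivT a b T F) z = pderivT a b T (pderivS a b T F) z := by
  have hU := uniqueDiffOn_dom (T := T) hab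
  have hsym : IsSymmSndFDerivWithinAt ℝ F (dom a b T) z := by
    refine (hF z hz).isSymmSndFDerivWithinAt
      (by simpa using WithTop.coe_le_coe.2 (le_top : (2 : ℕ∞) ≤ ⊤)) hU ?_ hz
    rw [dom, interior_prod_eq, isOpen_Ioo.interior_eq, interior_Icc, closure_prod_eq,
      closure_Ioo hab.ne]
    exact ⟨subset_closure hz.1, hz.2⟩
  have hd : DifferentiableWithinAt ℝ (fderivWithin ℝ F (dom a b T)) (dom a b T) z :=
    (hF.fderivWithin hU (m := ∞) (by simp)).differentiableOn (by simp) z hz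
  have key : ∀ u v : ℝ × ℝ, fderivWithin ℝ (fun y => fderivWithin ℝ F (dom a b T) y u)
      (dom a b T) z v = fderivWithin ℝ (fderivWithin ℝ F (dom a b T)) (dom a b T) z v u := by
    intro u v
    rw [fderivWithin_clm_apply (hU z hz) hd (differentiableWithinAt_const u)]
    simp
  change fderivWithin ℝ (fun y => fderivWithin ℝ F (dom a b T) y (1, 0)) (dom a b T) z (0, 1) =
    fderivWithin ℝ (fun y => fderivWithin ℝ F (dom a b T) y (0, 1)) (dom a b T) z (1, 0)
  rw [key, key]
  exact hsym _ _

end Partial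

/-! ### From the motion of points to an equation for the radius -/

/-- The evolution of the radius function at positive times, with its partial derivatives named:
`rᵢ = ∂ₛⁱρ`, `rt = ∂ₜρ`, `rt1 = ∂ₜ∂ₛρ`, `rt2 = ∂ₜ∂ₛ²ρ`. -/
structure RadialFlow (n : ℕ) (a b T : ℝ) (ρ r1 r2 r3 r4 rt rt1 rt2 : ℝ → ℝ → ℝ) (h : ℝ → ℝ) :
    Prop where
  ds0 : ∀ t ∈ Ioo 0 T, ∀ s ∈ Icc a b, HasDerivWithinAt (ρ t) (r1 t s) (Icc a b) s
  ds1 : ∀ t ∈ Ioo 0 T, ∀ s ∈ Icc a b, HasDerivWithinAt (r1 t) (r2 t s) (Icc a b) s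
  ds2 : ∀ t ∈ Ioo 0 T, ∀ s ∈ Icc a b, HasDerivWithinAt (r2 t) (r3 t s) (Icc a b) s
  ds3 : ∀ t ∈ Ioo 0 T, ∀ s ∈ Icc a b, HasDerivWithinAt (r3 t) (r4 t s) (Icc a b) s
  dst0 : ∀ t ∈ Ioo 0 T, ∀ s ∈ Icc a b, HasDerivWithinAt (rt t) (rt1 t s) (Icc a b) s
  dst1 : ∀ t ∈ Ioo 0 T, ∀ s ∈ Icc a b, HasDerivWithinAt (rt1 t) (rt2 t s) (Icc a b) s
  dt0 : ∀ t ∈ Ioo 0 T, ∀ s ∈ Icc a b, HasDerivAt (fun τ => ρ τ s) (rt t s) t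
  dt1 : ∀ t ∈ Ioo 0 T, ∀ s ∈ Icc a b, HasDerivAt (fun τ => r1 τ s) (rt1 t s) t
  dt2 : ∀ t ∈ Ioo 0 T, ∀ s ∈ Icc a b, HasDerivAt (fun τ => r2 τ s) (rt2 t s) t
  cont0 : ContinuousOn (fun z : ℝ × ℝ => ρ z.1 z.2) (dom a b T)
  cont1 : ContinuousOn (fun z : ℝ × ℝ => r1 z.1 z.2) (dom a b T)
  cont2 : ContinuousOn (fun z : ℝ × ℝ => r2 z.1 z.2) (dom a b T)
  cont_t0 : ContinuousOn (fun z : ℝ × ℝ => rt z.1 z.2) (dom a b T)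
  cont_t1 : ContinuousOn (fun z : ℝ × ℝ => rt1 z.1 z.2) (dom a b T)
  pos : ∀ t ∈ Ioo 0 T, ∀ s ∈ Icc a b, 0 < ρ t s
  neumann : ∀ t ∈ Ioo 0 T, r1 t a = 0 ∧ r1 t b = 0
  pde : ∀ t ∈ Ioo 0 T, ∀ s ∈ Icc a b, rt t s =
    r2 t s / (1 + r1 t s ^ 2) - (n - 1) / ρ t s + h t * √(1 + r1 t s ^ 2)
  volume : ∀ t ∈ Ioo 0 T, ∫ s in a..b, rt t s * ρ t s ^ (n - 1) = 0

variable {n : ℕ} {a b T : ℝ} {ρ : ℝ → ℝ → ℝ} {x : Amb n → ℝ → Amb n}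

theorem exists_unit_vector (hn : 2 ≤ n) :
    Nonempty (Metric.sphere (0 : EuclideanSpace ℝ (Fin n)) 1) :=
  ⟨⟨EuclideanSpace.single ⟨0, by omega⟩ 1, by simp⟩⟩

theorem slope_eq_of_hasDerivWithinAt (hab : a < b) {r : ℝ → ℝ} {c s : ℝ}
    (hs : s ∈ Icc a b) (h : HasDerivWithinAt r c (Icc a b) s) : slope a b r s = c :=
  h.derivWithin (uniqueDiffOn_Icc hab s hs)

theorem hasDerivWithinAt_slope (hab : a < b) {r r1 : ℝ → ℝ} {c : ℝ}
    (h : ∀ s ∈ Icc a b, HasDerivWithinAt r (r1 s) (Icc a b) s) {s : ℝ} (hs : s ∈ Icc a b)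
    (h1 : HasDerivWithinAt r1 c (Icc a b) s) : HasDerivWithinAt (slope a b r) c (Icc a b) s :=
  h1.congr (fun s' hs' => slope_eq_of_hasDerivWithinAt hab hs' (h s' hs'))
    (slope_eq_of_hasDerivWithinAt hab hs (h s hs))

/-- The mean curvature of the surface of revolution with radius `r`, slope `w` and `r'' = q`. -/
noncomputable def profileH (n : ℕ) (r w q : ℝ) : ℝ :=
  -(q / √(1 + w ^ 2) ^ 3) + (n - 1) * (1 / (r * √(1 + w ^ 2)))

theorem meanCurv_eq_profileH (hab : a < b) {r r1 r2 : ℝ → ℝ}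
    (hpos : ∀ s ∈ Icc a b, 0 < r s)
    (h0 : ∀ s ∈ Icc a b, HasDerivWithinAt r (r1 s) (Icc a b) s)
    (h1 : ∀ s ∈ Icc a b, HasDerivWithinAt r1 (r2 s) (Icc a b) s)
    {z : Amb n} (hz : z ∈ revSurface n a b r) :
    meanCurv a b r z = profileH n (r (z 0)) (r1 (z 0)) (r2 (z 0)) := by
  obtain ⟨hzs, hzh⟩ := hz
  rw [meanCurv_eq hab hzs (hzh ▸ hpos _ hzs) (hasDerivWithinAt_slope hab h0 hzs (h1 _ hzs)),
    slope_eq_of_hasDerivWithinAt hab hzs (h0 _ hzs), hzh, profileH]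

theorem avgMeanCurv_mul_integral (hn : 2 ≤ n) (hab : a < b) {r r1 r2 : ℝ → ℝ}
    (hpos : ∀ s ∈ Icc a b, 0 < r s)
    (h0 : ∀ s ∈ Icc a b, HasDerivWithinAt r (r1 s) (Icc a b) s)
    (h1 : ∀ s ∈ Icc a b, HasDerivWithinAt r1 (r2 s) (Icc a b) s) :
    avgMeanCurv n a b r * ∫ s in a..b, r s ^ (n - 1) * √(1 + r1 s ^ 2) =
      ∫ s in a..b, profileH n (r s) (r1 s) (r2 s) * (r s ^ (n - 1) * √(1 + r1 s ^ 2)) := by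
  have hσ := toSphere_real_univ_pos hn
  have hsl : ∀ s ∈ Icc a b, slope a b r s = r1 s := fun s hs =>
    slope_eq_of_hasDerivWithinAt hab hs (h0 s hs)
  have hsl' : ∀ F : ℝ → ℝ, ∫ s in a..b, F s * (r s ^ (n - 1) * √(1 + slope a b r s ^ 2)) =
      ∫ s in a..b, F s * (r s ^ (n - 1) * √(1 + r1 s ^ 2)) := fun F =>
    intervalIntegral.integral_congr fun s hs => by
      rw [uIcc_of_le hab.le] at hs
      simp only [hsl s hs]
  have hr : ContinuousOn r (Icc a b) := fun s hs => (h0 s hs).continuousWithinAt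
  have hr1 : ContinuousOn r1 (Icc a b) := fun s hs => (h1 s hs).continuousWithinAt
  have hpos' : 0 < ∫ s in a..b, r s ^ (n - 1) * √(1 + r1 s ^ 2) := by
    refine intervalIntegral.intervalIntegral_pos_of_pos_on ?_ (fun s hs => ?_) hab
    · refine ContinuousOn.intervalIntegrable ?_
      rw [uIcc_of_le hab.le]
      fun_prop
    · have := hpos s (Ioo_subset_Icc_self hs)
      positivity
  rw [avgMeanCurv, surfIntegral_eq (f := fun _ => 1) hab.le (F := fun _ => 1) (fun _ _ _ => rfl),
    surfIntegral_eq hab.le (F := fun s => profileH n (r s) (r1 s) (r2 s)) (fun s hs θ => ?_)]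
  · rw [hsl', hsl']
    simp only [one_mul]
    field_simp
  · exact meanCurv_eq_profileH hab hpos h0 h1 (revPoint_mem hs (hpos s hs).le θ)

namespace IsFlow

/-- A material point x satisfies height x = ρ(t, x₁). With normal speed k = -(H - h), the height
changes at rate k/v and x₁ at rate -k ρ'/v, so differentiating the relation gives ρ_t = k/v + k
ρ'²/v = k v. -/
theorem hasDerivAt_radius (hflow : IsFlow n a b T ρ x) (hn : 2 ≤ n) (hab : a < b)
    {t s : ℝ} (ht : t ∈ Ioo 0 T) (hs : s ∈ Icc a b) :
    pderivT a b T (fun z => ρ z.1 z.2) (t, s) =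
      -(profileH n (ρ t s) (pderivS a b T (fun z => ρ z.1 z.2) (t, s))
        (pderivS a b T (pderivS a b T (fun z => ρ z.1 z.2)) (t, s)) - avgMeanCurv n a b (ρ t)) *
        √(1 + pderivS a b T (fun z => ρ z.1 z.2) (t, s) ^ 2) := by
  have hF : ContDiffOn ℝ ∞ (fun z : ℝ × ℝ => ρ z.1 z.2) (dom a b T) := hflow.smooth
  have h0 : ∀ s ∈ Icc a b, HasDerivWithinAt (ρ t) (pderivS a b T (fun z => ρ z.1 z.2) (t, s))
    (Icc a b) s := fun s hs => hasDerivWithinAt_pderivS hF ht hs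
  have h1 := fun s hs => hasDerivWithinAt_pderivS (contDiffOn_pderivS hab hF) ht (s := s) hs
  have ht' : t ∈ Ico 0 T := Ioo_subset_Ico_self ht
  obtain ⟨θ⟩ := exists_unit_vector hn
  have hp : revPoint (ρ t) s θ ∈ revSurface n a b (ρ t) :=
    revPoint_mem hs (hflow.pos t ht' s hs).le θ
  obtain ⟨l, hl, hlx⟩ := (hflow.position_image t ht').symm.subset hp
  have hmem : ∀ τ ∈ Ioo 0 T, x l τ ∈ revSurface n a b (ρ τ) := fun τ hτ =>
    (hflow.position_image τ (Ioo_subset_Ico_self hτ)).subset (mem_image_of_mem _ hl)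
  have hx := hflow.evolution l hl t ht
  simp only at hlx
  have hx0 : x l t 0 = s := by rw [hlx, revPoint_zero]
  have hhpos : 0 < height (x l t) := by
    rw [(hmem t ht).2, hx0]; exact hflow.pos t ht' s hs
  rw [meanCurv_eq_profileH hab (hflow.pos t ht') h0 h1 (hmem t ht), hx0] at hx
  set w := pderivS a b T (fun z => ρ z.1 z.2) (t, s) with hw
  set H := profileH n (ρ t s) w (pderivS a b T (pderivS a b T (fun z => ρ z.1 z.2)) (t, s))
  set k := -(H - avgMeanCurv n a b (ρ t)) with hk
  have hsl : slope a b (ρ t) s = w := slope_eq_of_hasDerivWithinAt hab hs (h0 s hs)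
  have hV : 0 < 1 + w ^ 2 := by positivity
  have hvv : 0 < √(1 + w ^ 2) := Real.sqrt_pos.2 hV
  have hγ : HasDerivAt (fun τ => x l τ 0) (k * (-w / √(1 + w ^ 2))) t := by
    refine ((EuclideanSpace.proj (𝕜 := ℝ) (0 : Fin (n + 1))).hasFDerivAt.comp_hasDerivAt t
      hx).congr_deriv ?_
    change (k • normal a b (ρ t) (x l t)) 0 = _
    rw [PiLp.smul_apply, normal, PiLp.smul_apply, PiLp.sub_apply, PiLp.smul_apply,
      radialDir_zero, axisDir_zero, hx0, hsl]
    simp only [smul_eq_mul]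
    field_simp
    ring
  have hh : HasDerivAt (fun τ => height (x l τ)) (k * (1 / √(1 + w ^ 2))) t := by
    refine ((hasFDerivAt_height hhpos).comp_hasDerivAt t hx).congr_deriv ?_
    rw [innerSL_apply_apply, real_inner_smul_right, real_inner_comm, inner_normal,
      inner_radialDir_self hhpos, radialDir_zero, hx0, hsl]
    field_simp
    ring
  have hc := hasDerivAt_comp_curve hF ht hγ (fun τ hτ => (hmem τ hτ).1)
  have heq : (fun τ => ρ τ (x l τ 0)) =ᶠ[𝓝 t] fun τ => height (x l τ) := by
    filter_upwards [isOpen_Ioo.mem_nhds ht] with τ hτ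
    exact (hmem τ hτ).2.symm
  have huniq := hc.unique (hh.congr_of_eventuallyEq heq)
  simp only [hx0, ← hw] at huniq
  have hsq := Real.sq_sqrt hV.le
  have e1 : pderivT a b T (fun z => ρ z.1 z.2) (t, s) =
    k * (1 / √(1 + w ^ 2)) - k * (-w / √(1 + w ^ 2)) * w := by linarith
  rw [e1]
  field_simp
  rw [hsq]
  ring

theorem exists_radialFlow (hflow : IsFlow n a b T ρ x) (hn : 2 ≤ n) (hab : a < b) :
    ∃ (r1 r2 r3 r4 rt rt1 rt2 : ℝ → ℝ → ℝ) (h : ℝ → ℝ),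
      RadialFlow n a b T ρ r1 r2 r3 r4 rt rt1 rt2 h := by
  have hF : ContDiffOn ℝ ∞ (fun z : ℝ × ℝ => ρ z.1 z.2) (dom a b T) := hflow.smooth
  have hpde := fun t s (ht : t ∈ Ioo 0 T) (hs : s ∈ Icc a b) => hflow.hasDerivAt_radius hn hab ht hs
  generalize hR : (fun z : ℝ × ℝ => ρ z.1 z.2) = F at *
  have hρ : ∀ t s, ρ t s = F (t, s) := fun t s => by rw [← hR]
  have hρ' : ∀ t, ρ t = fun s => F (t, s) := fun t => by rw [← hR]
  have hF1 := contDiffOn_pderivS hab hF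
  have hF2 := contDiffOn_pderivS hab hF1
  have hF3 := contDiffOn_pderivS hab hF2
  have hFt := contDiffOn_pderivT hab hF
  have hFt1 := contDiffOn_pderivT hab hF1
  have e1 : ∀ z ∈ dom a b T, pderivS a b T (pderivT a b T F) z = pderivT a b T (pderivS a b T F) z :=
    fun z hz => pderivS_pderivT hab hF hz
  have e2 : ∀ z ∈ dom a b T, pderivS a b T (pderivT a b T (pderivS a b T F)) z =
    pderivT a b T (pderivS a b T (pderivS a b T F)) z := fun z hz => pderivS_pderivT hab hF1 hz
  have hpos : ∀ t ∈ Ioo 0 T, ∀ s ∈ Icc a b, 0 < F (t, s) := fun t ht s hs =>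
    hρ t s ▸ hflow.pos t (Ioo_subset_Ico_self ht) s hs
  refine ⟨fun t s => pderivS a b T F (t, s), fun t s => pderivS a b T (pderivS a b T F) (t, s),
    fun t s => pderivS a b T (pderivS a b T (pderivS a b T F)) (t, s),
    fun t s => pderivS a b T (pderivS a b T (pderivS a b T (pderivS a b T F))) (t, s),
    fun t s => pderivT a b T F (t, s), fun t s => pderivT a b T (pderivS a b T F) (t, s),
    fun t s => pderivT a b T (pderivS a b T (pderivS a b T F)) (t, s),
    fun t => avgMeanCurv n a b (ρ t), ?_⟩
  have hds0 : ∀ t ∈ Ioo 0 T, ∀ s ∈ Icc a b,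
      HasDerivWithinAt (ρ t) (pderivS a b T F (t, s)) (Icc a b) s := fun t ht s hs => by
    rw [hρ' t]; exact hasDerivWithinAt_pderivS hF ht hs
  have hds1 : ∀ t ∈ Ioo 0 T, ∀ s ∈ Icc a b,
      HasDerivWithinAt (fun s => pderivS a b T F (t, s))
        (pderivS a b T (pderivS a b T F) (t, s)) (Icc a b) s := fun t ht s hs =>
    hasDerivWithinAt_pderivS hF1 ht hs
  have hpde' : ∀ t ∈ Ioo 0 T, ∀ s ∈ Icc a b, pderivT a b T F (t, s) =
      pderivS a b T (pderivS a b T F) (t, s) / (1 + pderivS a b T F (t, s) ^ 2) -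
      (n - 1) / ρ t s + avgMeanCurv n a b (ρ t) * √(1 + pderivS a b T F (t, s) ^ 2) := by
    intro t ht s hs
    have hp := hpos t ht s hs
    rw [← hρ] at hp
    have hV : 0 < 1 + pderivS a b T F (t, s) ^ 2 := by positivity
    have hvv := Real.sqrt_pos.2 hV
    have hsq := Real.sq_sqrt hV.le
    rw [hpde t s ht hs, profileH]
    generalize √(1 + pderivS a b T F (t, s) ^ 2) = v at *
    rw [← hsq]
    field_simp
    ring
  exact {
    ds0 := hds0
    ds1 := hds1
    ds2 := fun t ht s hs => hasDerivWithinAt_pderivS hF2 ht hs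
    ds3 := fun t ht s hs => hasDerivWithinAt_pderivS hF3 ht hs
    dst0 := fun t ht s hs => e1 (t, s) ⟨ht, hs⟩ ▸ hasDerivWithinAt_pderivS hFt ht hs
    dst1 := fun t ht s hs => e2 (t, s) ⟨ht, hs⟩ ▸ hasDerivWithinAt_pderivS hFt1 ht hs
    dt0 := fun t ht s hs => by
      simp only [hρ]; exact hasDerivAt_pderivT hF ht hs
    dt1 := fun t ht s hs => hasDerivAt_pderivT hF1 ht hs
    dt2 := fun t ht s hs => hasDerivAt_pderivT hF2 ht hs
    cont0 := by rw [hR]; exact hF.continuousOn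
    cont1 := hF1.continuousOn
    cont2 := hF2.continuousOn
    cont_t0 := hFt.continuousOn
    cont_t1 := hFt1.continuousOn
    pos := fun t ht s hs => hρ t s ▸ hpos t ht s hs
    neumann := fun t ht => by
      have := hflow.neumann t (Ioo_subset_Ico_self ht)
      rwa [slope_eq_of_hasDerivWithinAt hab (left_mem_Icc.2 hab.le)
        (hds0 t ht a (left_mem_Icc.2 hab.le)),
        slope_eq_of_hasDerivWithinAt hab (right_mem_Icc.2 hab.le)
        (hds0 t ht b (right_mem_Icc.2 hab.le))] at this
    pde := hpde'
    volume := fun t ht => by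
      have hpt : ∀ s ∈ Icc a b, 0 < ρ t s := hflow.pos t (Ioo_subset_Ico_self ht)
      have hm := avgMeanCurv_mul_integral hn hab hpt (hds0 t ht) (hds1 t ht)
      have hc0 : ContinuousOn (ρ t) (Icc a b) := fun s hs => (hds0 t ht s hs).continuousWithinAt
      have hc1 : ContinuousOn (fun s => pderivS a b T F (t, s)) (Icc a b) :=
        fun s hs => (hds1 t ht s hs).continuousWithinAt
      have hc2 : ContinuousOn (fun s => pderivS a b T (pderivS a b T F) (t, s)) (Icc a b) :=
        fun s hs => (hasDerivWithinAt_pderivS hF2 ht hs).continuousWithinAt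
      -- As ρ_t = -(H - h) v, the integral of ρ_t ρ^{n-1} is that of -(H - h) against the area
      -- density, which vanishes by the choice of h.
      rw [← intervalIntegral.integral_const_mul, ← sub_eq_zero,
        ← intervalIntegral.integral_sub] at hm
      · rw [← hm]
        refine intervalIntegral.integral_congr fun s hs => ?_
        rw [uIcc_of_le hab.le] at hs
        rw [hpde t s ht hs]
        ring
      · refine ContinuousOn.intervalIntegrable ?_
        rw [uIcc_of_le hab.le]
        fun_prop
      · refine ContinuousOn.intervalIntegrable ?_
        rw [uIcc_of_le hab.le]
        have hne : ∀ s ∈ Icc a b, √(1 + pderivS a b T F (t, s) ^ 2) ^ 3 ≠ 0 := fun s _ => by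
          positivity
        have hne' : ∀ s ∈ Icc a b, ρ t s * √(1 + pderivS a b T F (t, s) ^ 2) ≠ 0 := fun s hs => by
          have := hpt s hs
          positivity
        unfold profileH
        fun_prop (disch := assumption) }

end IsFlow

/-! ### Calculus on compact intervals -/

/-- Differentiation under the integral sign over a compact interval. -/
theorem hasDerivAt_integral_of_continuousOn_dom {a b T : ℝ} (hab : a ≤ b) {g gt : ℝ → ℝ → ℝ}
    (hg : ContinuousOn (fun z : ℝ × ℝ => g z.1 z.2) (dom a b T))
    (hgt : ContinuousOn (fun z : ℝ × ℝ => gt z.1 z.2) (dom a b T))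
    (hd : ∀ t ∈ Ioo 0 T, ∀ s ∈ Icc a b, HasDerivAt (fun τ => g τ s) (gt t s) t)
    {t : ℝ} (ht : t ∈ Ioo 0 T) :
    HasDerivAt (fun τ => ∫ s in a..b, g τ s) (∫ s in a..b, gt t s) t := by
  obtain ⟨δ, hδ, hball⟩ := Metric.nhds_basis_closedBall.mem_iff.1 (isOpen_Ioo.mem_nhds ht)
  have hK : IsCompact (Metric.closedBall t δ ×ˢ Icc a b) :=
    (isCompact_closedBall t δ).prod isCompact_Icc
  have hKd : Metric.closedBall t δ ×ˢ Icc a b ⊆ dom a b T := prod_mono hball le_rfl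
  obtain ⟨C, hC⟩ := hK.exists_bound_of_continuousOn (hgt.mono hKd)
  have slice : ∀ {f : ℝ → ℝ → ℝ}, ContinuousOn (fun z : ℝ × ℝ => f z.1 z.2) (dom a b T) →
      ∀ τ ∈ Ioo 0 T, ContinuousOn (f τ) (Icc a b) := fun hf τ hτ =>
    hf.comp (f := fun s : ℝ => (τ, s)) (by fun_prop) (fun s hs => mk_mem_prod hτ hs)
  have hI : uIoc a b ⊆ Icc a b := by rw [uIoc_of_le hab]; exact Ioc_subset_Icc_self
  refine (intervalIntegral.hasDerivAt_integral_of_dominated_loc_of_deriv_le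
    (F := g) (F' := gt) (bound := fun _ => C)
    (Metric.closedBall_mem_nhds t hδ) ?_ ?_ ?_ ?_ ?_ ?_).2
  · filter_upwards [isOpen_Ioo.mem_nhds ht] with τ hτ
    exact ((slice hg τ hτ).mono hI).aestronglyMeasurable measurableSet_uIoc
  · refine ContinuousOn.intervalIntegrable ?_
    rw [uIcc_of_le hab]; exact slice hg t ht
  · exact ((slice hgt t ht).mono hI).aestronglyMeasurable measurableSet_uIoc
  · exact Eventually.of_forall fun s hs τ hτ => hC (τ, s) ⟨hτ, hI hs⟩
  · exact intervalIntegrable_const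
  · exact Eventually.of_forall fun s hs τ hτ => hd τ (hball hτ) s (hI hs)

/-- The fundamental theorem of calculus for one-sided derivatives at the end points. -/
theorem integral_eq_sub_of_hasDerivWithinAt_Icc {a b : ℝ} (hab : a ≤ b) {f f' : ℝ → ℝ}
    (hd : ∀ s ∈ Icc a b, HasDerivWithinAt f (f' s) (Icc a b) s)
    (hc : ContinuousOn f' (Icc a b)) : ∫ s in a..b, f' s = f b - f a := by
  refine intervalIntegral.integral_eq_sub_of_hasDerivAt_of_le hab
    (fun s hs => (hd s hs).continuousWithinAt)
    (fun s hs => (hd s (Ioo_subset_Icc_self hs)).hasDerivAt (Icc_mem_nhds hs.1 hs.2)) ?_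
  refine ContinuousOn.intervalIntegrable ?_
  rwa [uIcc_of_le hab]

theorem intervalIntegrable_of_continuousOn_Icc {a b : ℝ} (hab : a ≤ b) {f : ℝ → ℝ}
    (hf : ContinuousOn f (Icc a b)) : IntervalIntegrable f volume a b := by
  refine ContinuousOn.intervalIntegrable ?_
  rwa [uIcc_of_le hab]

theorem sqrt_one_add_sq_pos (w : ℝ) : 0 < √(1 + w ^ 2) := by positivity

theorem sq_sqrt_one_add_sq (w : ℝ) : √(1 + w ^ 2) ^ 2 = 1 + w ^ 2 := Real.sq_sqrt (by positivity)

theorem abs_le_sqrt_one_add_sq (w : ℝ) : |w| ≤ √(1 + w ^ 2) :=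
  Real.abs_le_sqrt (by linarith)

theorem one_le_sqrt_one_add_sq (w : ℝ) : 1 ≤ √(1 + w ^ 2) := by
  rw [Real.one_le_sqrt]; nlinarith [sq_nonneg w]

theorem hasDerivWithinAt_sqrt_one_add_sq {f : ℝ → ℝ} {c s : ℝ} {S : Set ℝ}
    (hf : HasDerivWithinAt f c S s) :
    HasDerivWithinAt (fun s => √(1 + f s ^ 2)) (f s * c / √(1 + f s ^ 2)) S s := by
  refine (((hf.fun_pow 2).const_add 1).sqrt (by positivity)).congr_deriv ?_
  have := sqrt_one_add_sq_pos (f s)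
  field_simp
  norm_num
  ring

theorem hasDerivAt_sqrt_one_add_sq {f : ℝ → ℝ} {c s : ℝ} (hf : HasDerivAt f c s) :
    HasDerivAt (fun s => √(1 + f s ^ 2)) (f s * c / √(1 + f s ^ 2)) s := by
  rw [← hasDerivWithinAt_univ] at hf ⊢
  exact hasDerivWithinAt_sqrt_one_add_sq hf

/-! ### Volume, area and the time integral of h² -/

namespace RadialFlow

variable {n : ℕ} {a b T : ℝ} {ρ r1 r2 r3 r4 rt rt1 rt2 : ℝ → ℝ → ℝ} {h : ℝ → ℝ}

section Slices

variable (hR : RadialFlow n a b T ρ r1 r2 r3 r4 rt rt1 rt2 h) {t : ℝ} (ht : t ∈ Ioo 0 T)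

include hR ht

theorem contS0 : ContinuousOn (ρ t) (Icc a b) := fun s hs => (hR.ds0 t ht s hs).continuousWithinAt
theorem contS1 : ContinuousOn (r1 t) (Icc a b) := fun s hs => (hR.ds1 t ht s hs).continuousWithinAt
theorem contS2 : ContinuousOn (r2 t) (Icc a b) := fun s hs => (hR.ds2 t ht s hs).continuousWithinAt
theorem contSt : ContinuousOn (rt t) (Icc a b) := fun s hs => (hR.dst0 t ht s hs).continuousWithinAt
theorem contSt1 : ContinuousOn (rt1 t) (Icc a b) :=
  fun s hs => (hR.dst1 t ht s hs).continuousWithinAt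

end Slices

theorem volume_const (hR : RadialFlow n a b T ρ r1 r2 r3 r4 rt rt1 rt2 h) (hab : a ≤ b)
    {t t' : ℝ} (ht : t ∈ Ioo 0 T) (ht' : t' ∈ Ioo 0 T) :
    ∫ s in a..b, ρ t s ^ n = ∫ s in a..b, ρ t' s ^ n := by
  have hd : ∀ t ∈ Ioo 0 T, HasDerivAt (fun τ => ∫ s in a..b, ρ τ s ^ n) 0 t := by
    intro t ht
    have hc0 := hR.cont0
    have hct := hR.cont_t0
    refine (hasDerivAt_integral_of_continuousOn_dom hab (g := fun t s => ρ t s ^ n)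
      (gt := fun t s => n * (rt t s * ρ t s ^ (n - 1))) (by fun_prop) (by fun_prop)
      (fun t ht s hs => ((hR.dt0 t ht s hs).fun_pow n).congr_deriv (by ring)) ht).congr_deriv ?_
    rw [intervalIntegral.integral_const_mul, hR.volume t ht, mul_zero]
  exact isOpen_Ioo.is_const_of_deriv_eq_zero isPreconnected_Ioo
    (fun t ht => (hd t ht).differentiableAt.differentiableWithinAt)
    (fun t ht => (hd t ht).deriv) ht ht'

/-- First variation of area. Integration by parts has no end terms because ρ' = 0 there, and the
contribution of h drops out because the volume is preserved; what remains is a square. -/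
theorem hasDerivAt_area (hR : RadialFlow n a b T ρ r1 r2 r3 r4 rt rt1 rt2 h) (hn : 2 ≤ n)
    (hab : a ≤ b) {t : ℝ} (ht : t ∈ Ioo 0 T) :
    HasDerivAt (fun τ => ∫ s in a..b, ρ τ s ^ (n - 1) * √(1 + r1 τ s ^ 2))
      (-∫ s in a..b, ρ t s ^ (n - 1) * rt t s ^ 2 / √(1 + r1 t s ^ 2)) t := by
  obtain ⟨m, rfl⟩ : ∃ m, n = m + 2 := ⟨n - 2, by omega⟩
  have hvol := hR.volume t ht
  simp only [Nat.add_succ_sub_one] at hvol ⊢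
  have hc0 := hR.cont0
  have hc1 := hR.cont1
  have hct := hR.cont_t0
  have hct1 := hR.cont_t1
  have hne : ∀ z ∈ dom a b T, √(1 + r1 z.1 z.2 ^ 2) ≠ 0 := fun z _ =>
    (sqrt_one_add_sq_pos _).ne'
  refine (hasDerivAt_integral_of_continuousOn_dom hab
    (g := fun t s => ρ t s ^ (m + 1) * √(1 + r1 t s ^ 2))
    (gt := fun t s => (m + 1) * ρ t s ^ m * rt t s * √(1 + r1 t s ^ 2) +
      ρ t s ^ (m + 1) * (r1 t s * rt1 t s / √(1 + r1 t s ^ 2)))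
    (by fun_prop) (by fun_prop (disch := assumption))
    (fun t ht s hs => (((hR.dt0 t ht s hs).fun_pow (m + 1)).fun_mul
      (hasDerivAt_sqrt_one_add_sq (hR.dt1 t ht s hs))).congr_deriv (by push_cast; simp)) ht).congr_deriv ?_
  have cS0 := hR.contS0 ht
  have cS1 := hR.contS1 ht
  have cS2 := hR.contS2 ht
  have cSt := hR.contSt ht
  have cSt1 := hR.contSt1 ht
  have hneS : ∀ s ∈ Icc a b, √(1 + r1 t s ^ 2) ≠ 0 := fun s _ => (sqrt_one_add_sq_pos _).ne'
  have hneS3 : ∀ s ∈ Icc a b, √(1 + r1 t s ^ 2) ^ 3 ≠ 0 := fun s hs => pow_ne_zero _ (hneS s hs)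
  have hFTC : ∫ s in a..b, ((m + 1) * ρ t s ^ m * r1 t s * (r1 t s / √(1 + r1 t s ^ 2)) * rt t s +
      ρ t s ^ (m + 1) * (r2 t s / √(1 + r1 t s ^ 2) ^ 3) * rt t s +
      ρ t s ^ (m + 1) * (r1 t s / √(1 + r1 t s ^ 2)) * rt1 t s) = 0 := by
    rw [integral_eq_sub_of_hasDerivWithinAt_Icc hab
      (f := fun s => ρ t s ^ (m + 1) * (r1 t s / √(1 + r1 t s ^ 2)) * rt t s)]
    · simp [hR.neumann t ht]
    · intro s hs
      refine ((((hR.ds0 t ht s hs).fun_pow (m + 1)).fun_mul ((hR.ds1 t ht s hs).fun_div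
        (hasDerivWithinAt_sqrt_one_add_sq (hR.ds1 t ht s hs)) (hneS s hs))).fun_mul
        (hR.dst0 t ht s hs)).congr_deriv ?_
      have hv := sqrt_one_add_sq_pos (r1 t s)
      have hv2 := sq_sqrt_one_add_sq (r1 t s)
      generalize √(1 + r1 t s ^ 2) = v at *
      have : r1 t s ^ 2 = v ^ 2 - 1 := by linarith
      simp only [Nat.add_succ_sub_one]
      push_cast
      field_simp
      rw [this]
      ring
    · fun_prop (disch := assumption)
  -- Two vanishing integrals are added, the total derivative of ρ^{n-1} (ρ'/v) ρ_t and h times the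
  -- rate of change of volume; with them the integrands agree pointwise by the equation for ρ_t.
  have hsum : -∫ s in a..b, ρ t s ^ (m + 1) * rt t s ^ 2 / √(1 + r1 t s ^ 2) =
      (∫ s in a..b, ((m + 1) * ρ t s ^ m * r1 t s * (r1 t s / √(1 + r1 t s ^ 2)) * rt t s +
      ρ t s ^ (m + 1) * (r2 t s / √(1 + r1 t s ^ 2) ^ 3) * rt t s +
      ρ t s ^ (m + 1) * (r1 t s / √(1 + r1 t s ^ 2)) * rt1 t s)) +
      h t * (∫ s in a..b, rt t s * ρ t s ^ (m + 1)) -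
      ∫ s in a..b, ρ t s ^ (m + 1) * rt t s ^ 2 / √(1 + r1 t s ^ 2) := by
    rw [hFTC, hvol]; ring
  rw [hsum, ← intervalIntegral.integral_const_mul, ← intervalIntegral.integral_add,
    ← intervalIntegral.integral_sub]
  · refine intervalIntegral.integral_congr fun s hs => ?_
    rw [uIcc_of_le hab] at hs
    have hp := hR.pos t ht s hs
    have hv := sqrt_one_add_sq_pos (r1 t s)
    have hv2 := sq_sqrt_one_add_sq (r1 t s)
    have hpde := hR.pde t ht s hs
    push_cast at hpde
    rw [← hv2, Real.sqrt_sq hv.le] at hpde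
    have e1 : r2 t s = √(1 + r1 t s ^ 2) ^ 2 * (rt t s + (m + 2 - 1) / ρ t s -
      h t * √(1 + r1 t s ^ 2)) := by rw [hpde]; field_simp; ring
    rw [e1]
    generalize √(1 + r1 t s ^ 2) = v at *
    have : r1 t s ^ 2 = v ^ 2 - 1 := by linarith
    field_simp
    rw [this]
    ring
  all_goals
    refine intervalIntegrable_of_continuousOn_Icc hab ?_
    fun_prop (disch := assumption)

theorem area_nonneg (hR : RadialFlow n a b T ρ r1 r2 r3 r4 rt rt1 rt2 h) (hab : a ≤ b)
    {t : ℝ} (ht : t ∈ Ioo 0 T) : 0 ≤ ∫ s in a..b, ρ t s ^ (n - 1) * √(1 + r1 t s ^ 2) := by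
  refine intervalIntegral.integral_nonneg hab fun s hs => ?_
  have := hR.pos t ht s hs
  positivity

theorem area_antitone (hR : RadialFlow n a b T ρ r1 r2 r3 r4 rt rt1 rt2 h) (hn : 2 ≤ n)
    (hab : a ≤ b) :
    AntitoneOn (fun τ => ∫ s in a..b, ρ τ s ^ (n - 1) * √(1 + r1 τ s ^ 2)) (Ioo 0 T) := by
  have hd := fun t ht => hR.hasDerivAt_area hn hab (t := t) ht
  refine antitoneOn_of_deriv_nonpos (convex_Ioo 0 T)
    (fun t ht => (hd t ht).continuousAt.continuousWithinAt) ?_ ?_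
  · rw [interior_Ioo]
    exact fun t ht => (hd t ht).differentiableAt.differentiableWithinAt
  · rw [interior_Ioo]
    intro t ht
    rw [(hd t ht).deriv, neg_nonpos]
    refine intervalIntegral.integral_nonneg hab fun s hs => ?_
    have := hR.pos t ht s hs
    positivity

/-- One-dimensional Sobolev estimate: integrate the derivatives of (σ - a)ρⁿ over [a, s] and of (σ -
b)ρⁿ over [s, b], add, and use |ρ'| ≤ v. -/
theorem mul_pow_le (hR : RadialFlow n a b T ρ r1 r2 r3 r4 rt rt1 rt2 h)
    {t s : ℝ} (ht : t ∈ Ioo 0 T) (hs : s ∈ Icc a b) :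
    (b - a) * ρ t s ^ n ≤ (∫ s in a..b, ρ t s ^ n) +
      (b - a) * n * ∫ s in a..b, ρ t s ^ (n - 1) * √(1 + r1 t s ^ 2) := by
  have cS0 := hR.contS0 ht
  have cS1 := hR.contS1 ht
  have hab : a ≤ b := hs.1.trans hs.2
  have hla : Icc a s ⊆ Icc a b := Icc_subset_Icc_right hs.2
  have hlb : Icc s b ⊆ Icc a b := Icc_subset_Icc_left hs.1
  have hl : ∫ σ in a..s, (ρ t σ ^ n + (σ - a) * (n * ρ t σ ^ (n - 1) * r1 t σ)) =
      (s - a) * ρ t s ^ n := by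
    rw [integral_eq_sub_of_hasDerivWithinAt_Icc hs.1 (f := fun σ => (σ - a) * ρ t σ ^ n)]
    · simp
    · intro σ hσ
      refine (((hasDerivWithinAt_id σ (Icc a s)).sub_const a).fun_mul
        (((hR.ds0 t ht σ (hla hσ)).mono hla).fun_pow n)).congr_deriv ?_
      simp
    · have := cS0.mono hla
      have := cS1.mono hla
      fun_prop
  have hr : ∫ σ in s..b, (ρ t σ ^ n - (b - σ) * (n * ρ t σ ^ (n - 1) * r1 t σ)) =
      (b - s) * ρ t s ^ n := by
    rw [integral_eq_sub_of_hasDerivWithinAt_Icc hs.2 (f := fun σ => (σ - b) * ρ t σ ^ n)]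
    · simp only [sub_self]; ring
    · intro σ hσ
      refine (((hasDerivWithinAt_id σ (Icc s b)).sub_const b).fun_mul
        (((hR.ds0 t ht σ (hlb hσ)).mono hlb).fun_pow n)).congr_deriv ?_
      simp; ring
    · have := cS0.mono hlb
      have := cS1.mono hlb
      fun_prop
  have hint : ContinuousOn (fun σ => ρ t σ ^ n +
      (b - a) * n * (ρ t σ ^ (n - 1) * √(1 + r1 t σ ^ 2))) (Icc a b) := by fun_prop
  have key : ∀ σ ∈ Icc a b, ∀ c : ℝ, |c| ≤ b - a → c * (n * ρ t σ ^ (n - 1) * r1 t σ) ≤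
      (b - a) * n * (ρ t σ ^ (n - 1) * √(1 + r1 t σ ^ 2)) := by
    intro σ hσ c hc
    have hp := hR.pos t ht σ hσ
    have h1 : c * r1 t σ ≤ (b - a) * √(1 + r1 t σ ^ 2) :=
      (le_abs_self _).trans (by
        rw [abs_mul]
        exact mul_le_mul hc (abs_le_sqrt_one_add_sq _) (abs_nonneg _) (by linarith))
    have h2 : 0 ≤ n * ρ t σ ^ (n - 1) := by positivity
    calc c * (n * ρ t σ ^ (n - 1) * r1 t σ) = (n * ρ t σ ^ (n - 1)) * (c * r1 t σ) := by ring
      _ ≤ (n * ρ t σ ^ (n - 1)) * ((b - a) * √(1 + r1 t σ ^ 2)) :=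
        mul_le_mul_of_nonneg_left h1 h2
      _ = _ := by ring
  have hl' : (s - a) * ρ t s ^ n ≤ ∫ σ in a..s, (ρ t σ ^ n +
      (b - a) * n * (ρ t σ ^ (n - 1) * √(1 + r1 t σ ^ 2))) := by
    rw [← hl]
    refine intervalIntegral.integral_mono_on hs.1 ?_
      (intervalIntegrable_of_continuousOn_Icc hs.1 (hint.mono hla)) fun σ hσ => ?_
    · have := cS0.mono hla
      have := cS1.mono hla
      exact intervalIntegrable_of_continuousOn_Icc hs.1 (by fun_prop)
    · have := key σ (hla hσ) (σ - a) (by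
        rw [abs_of_nonneg (sub_nonneg.2 hσ.1)]; linarith [hσ.2, hs.2])
      linarith
  have hr' : (b - s) * ρ t s ^ n ≤ ∫ σ in s..b, (ρ t σ ^ n +
      (b - a) * n * (ρ t σ ^ (n - 1) * √(1 + r1 t σ ^ 2))) := by
    rw [← hr]
    refine intervalIntegral.integral_mono_on hs.2 ?_
      (intervalIntegrable_of_continuousOn_Icc hs.2 (hint.mono hlb)) fun σ hσ => ?_
    · have := cS0.mono hlb
      have := cS1.mono hlb
      exact intervalIntegrable_of_continuousOn_Icc hs.2 (by fun_prop)
    · have := key σ (hlb hσ) (-(b - σ)) (by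
        rw [abs_neg, abs_of_nonneg (sub_nonneg.2 hσ.2)]; linarith [hσ.1, hs.1])
      linarith
  have hadd := intervalIntegral.integral_add_adjacent_intervals
    (intervalIntegrable_of_continuousOn_Icc hs.1 (hint.mono hla))
    (intervalIntegrable_of_continuousOn_Icc hs.2 (hint.mono hlb))
  rw [← intervalIntegral.integral_const_mul, ← intervalIntegral.integral_add
    (intervalIntegrable_of_continuousOn_Icc hab (by fun_prop))
    (intervalIntegrable_of_continuousOn_Icc hab (by fun_prop)), ← hadd]
  linarith

/-- The radius is bounded away from the initial time. -/
theorem exists_radius_bound (hR : RadialFlow n a b T ρ r1 r2 r3 r4 rt rt1 rt2 h) (hn : 2 ≤ n)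
    (hab : a < b) {t₀ : ℝ} (ht₀ : t₀ ∈ Ioo 0 T) :
    ∃ R, 0 < R ∧ ∀ t ∈ Ico t₀ T, ∀ s ∈ Icc a b, ρ t s ≤ R := by
  set U := ∫ s in a..b, ρ t₀ s ^ n with hU
  set A₀ := ∫ s in a..b, ρ t₀ s ^ (n - 1) * √(1 + r1 t₀ s ^ 2) with hA
  have hA0 : 0 ≤ A₀ := hR.area_nonneg hab.le ht₀
  have hU0 : 0 ≤ U := by
    refine intervalIntegral.integral_nonneg hab.le fun s hs => ?_
    have := hR.pos t₀ ht₀ s hs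
    positivity
  have hba : 0 < b - a := sub_pos.2 hab
  -- The estimate is for ρⁿ; the summand 1 covers ρ < 1, and for ρ ≥ 1 one has ρ ≤ ρⁿ.
  refine ⟨1 + (U / (b - a) + n * A₀), by positivity, fun t ht s hs => ?_⟩
  have ht' : t ∈ Ioo 0 T := ⟨ht₀.1.trans_le ht.1, ht.2⟩
  have h1 := hR.mul_pow_le ht' hs
  have h2 := hR.area_antitone hn hab.le ht₀ ht' ht.1
  simp only at h2
  rw [hR.volume_const hab.le ht' ht₀, ← hU] at h1
  have h3 : ρ t s ^ n ≤ U / (b - a) + n * A₀ := by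
    have : (b - a) * ρ t s ^ n ≤ (b - a) * (U / (b - a) + n * A₀) := by
      refine h1.trans ?_
      have : (b - a) * (U / (b - a) + n * A₀) = U + (b - a) * n * A₀ := by field_simp
      rw [this]
      gcongr
    exact le_of_mul_le_mul_left this hba
  by_contra! hlt
  have h4 : 1 ≤ ρ t s := by
    have : 0 ≤ U / (b - a) + n * A₀ := by positivity
    linarith
  have h5 := le_self_pow₀ h4 (show n ≠ 0 by omega)
  linarith

/-- The equation tested with ρⁿ. The weight removes the singularity of (n-1)/ρ, and ρ''/(1 + ρ'²) =
(arctan ρ')' is integrated by parts. This trades the second derivative for a term controlled by the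
area. -/
theorem avg_mul_integral (hR : RadialFlow n a b T ρ r1 r2 r3 r4 rt rt1 rt2 h) (hn : 2 ≤ n)
    (hab : a ≤ b) {t : ℝ} (ht : t ∈ Ioo 0 T) :
    h t * ∫ s in a..b, ρ t s ^ n * √(1 + r1 t s ^ 2) = (∫ s in a..b, ρ t s ^ n * rt t s) +
      ∫ s in a..b, ((n - 1) * ρ t s ^ (n - 1) +
        n * ρ t s ^ (n - 1) * (r1 t s * Real.arctan (r1 t s))) := by
  obtain ⟨m, rfl⟩ : ∃ m, n = m + 2 := ⟨n - 2, by omega⟩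
  have cS0 := hR.contS0 ht
  have cS1 := hR.contS1 ht
  have cS2 := hR.contS2 ht
  have cSt := hR.contSt ht
  have cSa : ContinuousOn (fun s => Real.arctan (r1 t s)) (Icc a b) :=
    Real.continuous_arctan.comp_continuousOn cS1
  have hne : ∀ s ∈ Icc a b, 1 + r1 t s ^ 2 ≠ 0 := fun s _ => by positivity
  have hFTC : ∫ s in a..b, ((m + 2) * ρ t s ^ (m + 1) * r1 t s * Real.arctan (r1 t s) +
      ρ t s ^ (m + 2) * (r2 t s / (1 + r1 t s ^ 2))) = 0 := by
    rw [integral_eq_sub_of_hasDerivWithinAt_Icc hab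
      (f := fun s => ρ t s ^ (m + 2) * Real.arctan (r1 t s))]
    · simp [hR.neumann t ht]
    · intro s hs
      refine (((hR.ds0 t ht s hs).fun_pow (m + 2)).fun_mul
        (hR.ds1 t ht s hs).arctan).congr_deriv ?_
      simp only [Nat.add_succ_sub_one]
      push_cast
      ring
    · fun_prop (disch := assumption)
  rw [← add_zero (∫ s in a..b, ((((m + 2 : ℕ) : ℝ) - 1) * _ + _)), ← sub_self (0 : ℝ)]
  nth_rewrite 1 [← hFTC]
  rw [sub_zero, ← intervalIntegral.integral_const_mul]
  have : (∫ s in a..b, ρ t s ^ (m + 2) * rt t s) +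
      ((∫ s in a..b, ((((m + 2 : ℕ) : ℝ) - 1) * ρ t s ^ (m + 2 - 1) +
        ((m + 2 : ℕ) : ℝ) * ρ t s ^ (m + 2 - 1) * (r1 t s * Real.arctan (r1 t s)))) -
      ∫ s in a..b, ((m + 2) * ρ t s ^ (m + 1) * r1 t s * Real.arctan (r1 t s) +
      ρ t s ^ (m + 2) * (r2 t s / (1 + r1 t s ^ 2)))) =
      ∫ s in a..b, h t * (ρ t s ^ (m + 2) * √(1 + r1 t s ^ 2)) := by
    rw [← intervalIntegral.integral_sub, ← intervalIntegral.integral_add]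
    · refine intervalIntegral.integral_congr fun s hs => ?_
      rw [uIcc_of_le hab] at hs
      have hp := hR.pos t ht s hs
      have hpde := hR.pde t ht s hs
      simp only [Nat.add_succ_sub_one]
      rw [hpde]
      push_cast
      field_simp
      ring
    all_goals
      refine intervalIntegrable_of_continuousOn_Icc hab ?_
      fun_prop (disch := assumption)
  rw [← this, hFTC]
  ring

/-- In the tested equation the ρ_t term is handled by Young's inequality, half of it being absorbed
on the left, and the other terms by the area. The integral on the right is the rate of area loss, so
h² is integrable in time. -/
theorem sq_avg_le (hR : RadialFlow n a b T ρ r1 r2 r3 r4 rt rt1 rt2 h) (hn : 2 ≤ n)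
    (hab : a < b) {t R U A : ℝ} (ht : t ∈ Ioo 0 T) (hρ : ∀ s ∈ Icc a b, ρ t s ≤ R)
    (hU : 0 < U) (hUt : ∫ s in a..b, ρ t s ^ n = U)
    (hA : ∫ s in a..b, ρ t s ^ (n - 1) * √(1 + r1 t s ^ 2) ≤ A) :
    h t ^ 2 ≤ 2 * R / U * (∫ s in a..b, ρ t s ^ (n - 1) * rt t s ^ 2 / √(1 + r1 t s ^ 2)) +
      (6 * n * A / U) ^ 2 := by
  have cS0 := hR.contS0 ht
  have cS1 := hR.contS1 ht
  have cSt := hR.contSt ht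
  have cSa : ContinuousOn (fun s => Real.arctan (r1 t s)) (Icc a b) :=
    Real.continuous_arctan.comp_continuousOn cS1
  have hne : ∀ s ∈ Icc a b, √(1 + r1 t s ^ 2) ≠ 0 := fun s _ => (sqrt_one_add_sq_pos _).ne'
  have hid := hR.avg_mul_integral hn hab.le ht
  have hA0 := hR.area_nonneg hab.le ht
  set Y := ∫ s in a..b, ρ t s ^ n * √(1 + r1 t s ^ 2) with hY
  set D := ∫ s in a..b, ρ t s ^ (n - 1) * rt t s ^ 2 / √(1 + r1 t s ^ 2) with hD
  set J := ∫ s in a..b, ρ t s ^ n * rt t s with hJ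
  set E := ∫ s in a..b, ((n - 1) * ρ t s ^ (n - 1) +
        n * ρ t s ^ (n - 1) * (r1 t s * Real.arctan (r1 t s))) with hE
  have hn1 : (2 : ℝ) ≤ n := by exact_mod_cast hn
  have hUY : U ≤ Y := by
    rw [← hUt]
    refine intervalIntegral.integral_mono_on hab.le
      (intervalIntegrable_of_continuousOn_Icc hab.le (by fun_prop))
      (intervalIntegrable_of_continuousOn_Icc hab.le (by fun_prop)) fun s hs => ?_
    have := hR.pos t ht s hs
    exact le_mul_of_one_le_right (by positivity) (one_le_sqrt_one_add_sq _)
  have hD0 : 0 ≤ D := by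
    refine intervalIntegral.integral_nonneg hab.le fun s hs => ?_
    have := hR.pos t ht s hs
    positivity
  have hR0 : 0 ≤ R :=
    (hR.pos t ht a (left_mem_Icc.2 hab.le)).le.trans (hρ a (left_mem_Icc.2 hab.le))
  have hJle : 2 * h t * J ≤ h t ^ 2 * Y + R * D := by
    rw [hJ, hY, hD, ← intervalIntegral.integral_const_mul, ← intervalIntegral.integral_const_mul,
      ← intervalIntegral.integral_const_mul, ← intervalIntegral.integral_add
      (intervalIntegrable_of_continuousOn_Icc hab.le (by fun_prop))
      (intervalIntegrable_of_continuousOn_Icc hab.le (by fun_prop (disch := assumption)))]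
    refine intervalIntegral.integral_mono_on hab.le
      (intervalIntegrable_of_continuousOn_Icc hab.le (by fun_prop))
      (intervalIntegrable_of_continuousOn_Icc hab.le (by fun_prop (disch := assumption)))
      fun s hs => ?_
    have hp := hR.pos t ht s hs
    have hv := sqrt_one_add_sq_pos (r1 t s)
    have hle := hρ s hs
    generalize √(1 + r1 t s ^ 2) = v at *
    obtain ⟨m, rfl⟩ : ∃ m, n = m + 1 := ⟨n - 1, by omega⟩
    simp only [Nat.add_sub_cancel]
    have h1 : 2 * h t * rt t s ≤ h t ^ 2 * v + rt t s ^ 2 / v := by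
      rw [← sub_nonneg]
      have : h t ^ 2 * v + rt t s ^ 2 / v - 2 * h t * rt t s = (h t * v - rt t s) ^ 2 / v := by
        field_simp; ring
      rw [this]; positivity
    calc 2 * h t * (ρ t s ^ (m + 1) * rt t s) = ρ t s ^ (m + 1) * (2 * h t * rt t s) := by ring
      _ ≤ ρ t s ^ (m + 1) * (h t ^ 2 * v + rt t s ^ 2 / v) := by gcongr
      _ = h t ^ 2 * (ρ t s ^ (m + 1) * v) + ρ t s * (ρ t s ^ m * rt t s ^ 2 / v) := by ring
      _ ≤ _ := by gcongr
  -- The constant is 3n = n + 2n, the second part from |arctan| ≤ π/2 ≤ 2.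
  have hEle : |E| ≤ 3 * n * A := by
    have : |E| ≤ ∫ s in a..b, 3 * n * (ρ t s ^ (n - 1) * √(1 + r1 t s ^ 2)) := by
      rw [← Real.norm_eq_abs]
      refine intervalIntegral.norm_integral_le_of_norm_le hab.le ?_
        (intervalIntegrable_of_continuousOn_Icc hab.le (by fun_prop))
      refine Eventually.of_forall fun s hs => ?_
      have hp := hR.pos t ht s (Ioc_subset_Icc_self hs)
      have h1 := one_le_sqrt_one_add_sq (r1 t s)
      have h2 := abs_le_sqrt_one_add_sq (r1 t s)
      have h3 : |Real.arctan (r1 t s)| ≤ 2 := by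
        rw [abs_le]
        have := Real.pi_lt_four
        constructor <;> linarith [Real.neg_pi_div_two_lt_arctan (r1 t s),
          Real.arctan_lt_pi_div_two (r1 t s)]
      have h4 : |r1 t s * Real.arctan (r1 t s)| ≤ √(1 + r1 t s ^ 2) * 2 := by
        rw [abs_mul]; gcongr
      rw [Real.norm_eq_abs]
      generalize √(1 + r1 t s ^ 2) = v at *
      generalize r1 t s * Real.arctan (r1 t s) = y at *
      have hp1 : 0 < ρ t s ^ (n - 1) := by positivity
      generalize ρ t s ^ (n - 1) = p at *
      calc |((n : ℝ) - 1) * p + n * p * y| ≤ |((n : ℝ) - 1) * p| + |n * p * y| := abs_add_le _ _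
        _ = (n - 1) * p + n * p * |y| := by
          rw [abs_mul (n * p), abs_of_nonneg (by positivity : 0 ≤ n * p),
            abs_of_nonneg (mul_nonneg (by linarith) hp1.le)]
        _ ≤ n * p * v + n * p * (v * 2) := by
          have : ((n : ℝ) - 1) * p ≤ n * p * v := by nlinarith [mul_pos (by linarith : (0:ℝ) < n) hp1]
          have : n * p * |y| ≤ n * p * (v * 2) := by gcongr
          linarith
        _ = _ := by ring
    rw [intervalIntegral.integral_const_mul] at this
    refine this.trans ?_
    gcongr
  have hY0 : 0 < Y := hU.trans_le hUY
  have hAA : 0 ≤ A := hA0.trans hA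
  have h1 : 2 * h t * E ≤ 6 * n * A * |h t| := by
    calc 2 * h t * E ≤ |2 * h t * E| := le_abs_self _
      _ = 2 * |h t| * |E| := by rw [abs_mul, abs_mul, abs_two]
      _ ≤ 2 * |h t| * (3 * n * A) := by gcongr
      _ = _ := by ring
  have h2 : h t ^ 2 * Y ≤ R * D + 6 * n * A * |h t| := by
    have : 2 * h t * (h t * Y) = 2 * h t * J + 2 * h t * E := by rw [hid]; ring
    nlinarith
  have h3 : h t ^ 2 * U ≤ R * D + 6 * n * A * |h t| :=
    (mul_le_mul_of_nonneg_left hUY (sq_nonneg _)).trans h2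
  have h4 : h t ^ 2 ≤ R * D / U + 6 * n * A / U * |h t| := by
    have : R * D / U + 6 * n * A / U * |h t| = (R * D + 6 * n * A * |h t|) / U := by ring
    rw [this, le_div_iff₀ hU]; exact h3
  have h5 : 2 * R / U * D = 2 * (R * D / U) := by ring
  rw [h5]
  have h6 : h t ^ 2 = |h t| ^ 2 := (sq_abs _).symm
  rw [h6] at h4 ⊢
  -- From h² ≤ X + c|h| and c|h| ≤ (c² + h²)/2 follows h² ≤ 2X + c².
  nlinarith [sq_nonneg (6 * n * A / U - |h t|)]

/-- A bounded function of time whose derivative dominates the square of the averaged mean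
curvature. -/
theorem exists_barrier (hR : RadialFlow n a b T ρ r1 r2 r3 r4 rt rt1 rt2 h) (hn : 2 ≤ n)
    (hab : a < b) {t₀ : ℝ} (ht₀ : t₀ ∈ Ioo 0 T) :
    ∃ (B B' : ℝ → ℝ) (C : ℝ), (∀ t ∈ Ioo 0 T, HasDerivAt B (B' t) t) ∧
      (∀ t ∈ Ico t₀ T, h t ^ 2 + 1 ≤ B' t) ∧ ∀ t ∈ Ico t₀ T, |B t| ≤ C := by
  obtain ⟨R, hR0, hRle⟩ := hR.exists_radius_bound hn hab ht₀
  set U := ∫ s in a..b, ρ t₀ s ^ n with hU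
  set A := fun τ => ∫ s in a..b, ρ τ s ^ (n - 1) * √(1 + r1 τ s ^ 2) with hA
  have hmem : ∀ t ∈ Ico t₀ T, t ∈ Ioo 0 T := fun t ht => ⟨ht₀.1.trans_le ht.1, ht.2⟩
  have hU0 : 0 < U := by
    have := hR.contS0 ht₀
    refine intervalIntegral.intervalIntegral_pos_of_pos_on
      (intervalIntegrable_of_continuousOn_Icc hab.le (by fun_prop)) (fun s hs => ?_) hab
    have := hR.pos t₀ ht₀ s (Ioo_subset_Icc_self hs)
    positivity
  have hAle : ∀ t ∈ Ico t₀ T, A t ≤ A t₀ := fun t ht =>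
    hR.area_antitone hn hab.le ht₀ (hmem t ht) ht.1
  -- B is linear in t minus a multiple of the area: the derivative of the area supplies the
  -- dissipation bounding h², and B is bounded because T is finite and the area decreases. The extra
  -- +1 gives strict inequalities in the maximum principle.
  refine ⟨fun t => ((6 * n * A t₀ / U) ^ 2 + 1) * t - 2 * R / U * A t, fun t =>
    ((6 * n * A t₀ / U) ^ 2 + 1) + 2 * R / U *
      ∫ s in a..b, ρ t s ^ (n - 1) * rt t s ^ 2 / √(1 + r1 t s ^ 2),
    ((6 * n * A t₀ / U) ^ 2 + 1) * T + 2 * R / U * A t₀, fun t ht => ?_, fun t ht => ?_,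
    fun t ht => ?_⟩
  · refine (((hasDerivAt_id t).const_mul _).sub
      ((hR.hasDerivAt_area hn hab.le ht).const_mul (2 * R / U))).congr_deriv ?_
    ring
  · have := hR.sq_avg_le hn hab (hmem t ht) (hRle t ht) hU0
      (hR.volume_const hab.le (hmem t ht) ht₀) (hAle t ht)
    linarith
  · have h1 : 0 ≤ 2 * R / U * A t :=
      mul_nonneg (by positivity) (hR.area_nonneg hab.le (hmem t ht))
    have h2 : 2 * R / U * A t ≤ 2 * R / U * A t₀ :=
      mul_le_mul_of_nonneg_left (hAle t ht) (by positivity)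
    have h3 : ((6 * n * A t₀ / U) ^ 2 + 1) * t ≤ ((6 * n * A t₀ / U) ^ 2 + 1) * T :=
      mul_le_mul_of_nonneg_left ht.2.le (by positivity)
    have h4 : 0 ≤ ((6 * n * A t₀ / U) ^ 2 + 1) * t :=
      mul_nonneg (by positivity) (hmem t ht).1.le
    rw [abs_le]
    constructor <;> linarith

end RadialFlow

/-! ### Maximum principle tools -/

/-- The first and second order conditions at a local maximum over a compact interval, under Neumann
conditions at the end points. -/
theorem deriv_conditions_of_isLocalMaxOn_Icc {a b s c : ℝ} {g g₁ : ℝ → ℝ} (hab : a < b)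
    (hs : s ∈ Icc a b) (hmax : IsLocalMaxOn g (Icc a b) s)
    (hg : ∀ᶠ σ in 𝓝[Icc a b] s, HasDerivWithinAt g (g₁ σ) (Icc a b) σ)
    (hg₁ : HasDerivWithinAt g₁ c (Icc a b) s) (hN : s = a ∨ s = b → g₁ s = 0) :
    g₁ s = 0 ∧ c ≤ 0 := by
  have hzero : g₁ s = 0 := by
    by_cases hsa : s = a
    · exact hN (Or.inl hsa)
    by_cases hsb : s = b
    · exact hN (Or.inr hsb)
    have hnhds : Icc a b ∈ 𝓝 s :=
      Icc_mem_nhds (lt_of_le_of_ne hs.1 (Ne.symm hsa)) (lt_of_le_of_ne hs.2 hsb)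
    exact (hmax.isLocalMax hnhds).hasDerivAt_eq_zero
      ((hg.self_of_nhdsWithin hs).hasDerivAt hnhds)
  refine ⟨hzero, ?_⟩
  -- If c > 0, then g₁ has the sign of σ - s near s, and by the mean value theorem g increases away
  -- from s. One side is enough: the right one if s < b, the left one if s = b.
  by_contra! hc
  have hsl := hasDerivWithinAt_iff_tendsto_slope.1 hg₁
  have hpos : ∀ᶠ σ in 𝓝[Icc a b] s, σ ≠ s → 0 < _root_.slope g₁ s σ := by
    have := hsl.eventually (lt_mem_nhds hc)
    rw [sdiff_eq, nhdsWithin_inter', eventually_inf_principal] at this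
    exact this
  obtain ⟨δ, hδ, hball⟩ := Metric.mem_nhdsWithin_iff.1 ((hg.and hpos).and hmax)
  have hnear : ∀ σ ∈ Icc a b, |σ - s| < δ →
      HasDerivWithinAt g (g₁ σ) (Icc a b) σ ∧ (σ ≠ s → 0 < _root_.slope g₁ s σ) ∧ g σ ≤ g s := by
    intro σ hσ hd
    have := hball ⟨by rwa [Metric.mem_ball, Real.dist_eq], hσ⟩
    exact ⟨this.1.1, this.1.2, this.2⟩
  have mvt : ∀ p q, p ∈ Icc a b → q ∈ Icc a b → p < q → (∀ σ ∈ Icc p q, |σ - s| < δ) →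
      ∃ ξ ∈ Ioo p q, g₁ ξ = (g q - g p) / (q - p) := by
    intro p q hp hq hpq hd
    have hsub : Icc p q ⊆ Icc a b := Icc_subset_Icc hp.1 hq.2
    refine exists_hasDerivAt_eq_slope g g₁ hpq
      (fun σ hσ => ((hnear σ (hsub hσ) (hd σ hσ)).1.continuousWithinAt).mono hsub) fun σ hσ => ?_
    exact (hnear σ (hsub (Ioo_subset_Icc_self hσ)) (hd σ (Ioo_subset_Icc_self hσ))).1.hasDerivAt
      (Icc_mem_nhds (hp.1.trans_lt hσ.1) (hσ.2.trans_le hq.2))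
  rcases hs.2.lt_or_eq with hsb | hsb
  · set q := min b (s + δ / 2) with hq
    have hsq : s < q := lt_min hsb (by linarith)
    have hqb : q ≤ b := min_le_left _ _
    have hqδ : q ≤ s + δ / 2 := min_le_right _ _
    have hd : ∀ σ ∈ Icc s q, |σ - s| < δ := fun σ hσ => by
      rw [abs_of_nonneg (by linarith [hσ.1])]; linarith [hσ.2]
    have hqm : q ∈ Icc a b := ⟨hs.1.trans hsq.le, hqb⟩
    obtain ⟨ξ, hξ, he⟩ := mvt s q hs hqm hsq hd
    have h1 := (hnear ξ ⟨hs.1.trans hξ.1.le, hξ.2.le.trans hqb⟩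
      (hd ξ (Ioo_subset_Icc_self hξ))).2.1 hξ.1.ne'
    rw [slope_def_field, hzero, sub_zero, he] at h1
    have h2 := (hnear q hqm (hd q (right_mem_Icc.2 hsq.le))).2.2
    have h3 : (g q - g s) / (q - s) ≤ 0 :=
      div_nonpos_of_nonpos_of_nonneg (by linarith) (by linarith)
    exact absurd h1 (not_lt.2 (div_nonpos_of_nonpos_of_nonneg h3 (by linarith [hξ.1])))
  · have has : a < s := hsb ▸ hab
    set q := max a (s - δ / 2) with hq
    have hsq : q < s := max_lt has (by linarith)
    have hqb : a ≤ q := le_max_left _ _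
    have hqδ : s - δ / 2 ≤ q := le_max_right _ _
    have hd : ∀ σ ∈ Icc q s, |σ - s| < δ := fun σ hσ => by
      rw [abs_of_nonpos (by linarith [hσ.2])]; linarith [hσ.1]
    have hqm : q ∈ Icc a b := ⟨hqb, hsq.le.trans hs.2⟩
    obtain ⟨ξ, hξ, he⟩ := mvt q s hqm hs hsq hd
    have h1 := (hnear ξ ⟨hqb.trans hξ.1.le, hξ.2.le.trans hs.2⟩
      (hd ξ (Ioo_subset_Icc_self hξ))).2.1 hξ.2.ne
    rw [slope_def_field, hzero, sub_zero, he] at h1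
    have h2 := (hnear q hqm (hd q (left_mem_Icc.2 hsq.le))).2.2
    have h3 : 0 ≤ (g s - g q) / (s - q) := div_nonneg (by linarith) (by linarith)
    exact absurd h1 (not_lt.2 (div_nonpos_of_nonneg_of_nonpos h3 (by linarith [hξ.2])))

theorem deriv_nonneg_of_eventually_le_left {f : ℝ → ℝ} {c t : ℝ} (hd : HasDerivAt f c t)
    (hmax : ∀ᶠ τ in 𝓝[<] t, f τ ≤ f t) : 0 ≤ c := by
  have h := (hasDerivWithinAt_iff_tendsto_slope' (by simp)).1 (hd.hasDerivWithinAt (s := Iio t))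
  refine ge_of_tendsto h ?_
  filter_upwards [hmax, self_mem_nhdsWithin] with τ hτ hlt
  rw [slope_def_field]
  exact div_nonneg_of_nonpos (by linarith) (by linarith [mem_Iio.1 hlt])

/-- A maximum point over the part `{0 ≤ c}` of a space-time rectangle is, off the initial time and
off `{c = 0}`, a local maximum in space and a maximum over the recent past. -/
theorem exists_maximum_point {a b t₀ t₁ : ℝ} {f c : ℝ → ℝ → ℝ}
    (hc : ContinuousOn (fun z : ℝ × ℝ => c z.1 z.2) (Icc t₀ t₁ ×ˢ Icc a b))
    (hf : ContinuousOn (fun z : ℝ × ℝ => f z.1 z.2)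
      {z | z ∈ Icc t₀ t₁ ×ˢ Icc a b ∧ 0 ≤ c z.1 z.2})
    {t' s' : ℝ} (ht' : t' ∈ Icc t₀ t₁) (hs' : s' ∈ Icc a b) (hc' : 0 ≤ c t' s') :
    ∃ t ∈ Icc t₀ t₁, ∃ s ∈ Icc a b, 0 ≤ c t s ∧ f t' s' ≤ f t s ∧ (t₀ < t → 0 < c t s →
      IsLocalMaxOn (f t) (Icc a b) s ∧ ∀ᶠ τ in 𝓝[<] t, f τ s ≤ f t s) := by
  have hK : IsCompact (Icc t₀ t₁ ×ˢ Icc a b) := isCompact_Icc.prod isCompact_Icc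
  have hX : IsCompact {z : ℝ × ℝ | z ∈ Icc t₀ t₁ ×ˢ Icc a b ∧ 0 ≤ c z.1 z.2} :=
    hK.of_isClosed_subset (hc.preimage_isClosed_of_isClosed hK.isClosed isClosed_Ici)
      (fun z hz => hz.1)
  obtain ⟨⟨t, s⟩, ⟨⟨ht, hs⟩, hcz⟩, hmax⟩ := hX.exists_isMaxOn ⟨(t', s'), ⟨ht', hs'⟩, hc'⟩ hf
  replace hmax : ∀ τ σ, (τ, σ) ∈ {z : ℝ × ℝ | z ∈ Icc t₀ t₁ ×ˢ Icc a b ∧ 0 ≤ c z.1 z.2} →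
    f τ σ ≤ f t s := fun τ σ h => hmax h
  refine ⟨t, ht, s, hs, hcz, hmax _ _ ⟨⟨ht', hs'⟩, hc'⟩, fun h0 hpos => ⟨?_, ?_⟩⟩
  · have hcs : ContinuousWithinAt (c t) (Icc a b) s :=
      (hc (t, s) ⟨ht, hs⟩).comp (f := fun σ : ℝ => (t, σ)) (by fun_prop)
        (fun σ hσ => ⟨ht, hσ⟩)
    filter_upwards [hcs.eventually (lt_mem_nhds hpos), self_mem_nhdsWithin] with σ hσ hmem
    exact hmax _ _ ⟨⟨ht, hmem⟩, hσ.le⟩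
  · have hct : ContinuousWithinAt (fun τ => c τ s) (Icc t₀ t₁) t :=
      (hc (t, s) ⟨ht, hs⟩).comp (f := fun τ : ℝ => (τ, s)) (by fun_prop)
        (fun τ hτ => ⟨hτ, hs⟩)
    have hmem : Icc t₀ t₁ ∈ 𝓝[<] t := by
      filter_upwards [Ioo_mem_nhdsLT h0] with τ hτ
      exact ⟨hτ.1.le, hτ.2.le.trans ht.2⟩
    have hev := hct.eventually (lt_mem_nhds hpos)
    have hev' : ∀ᶠ τ in 𝓝[<] t, τ ∈ Icc t₀ t₁ → 0 < c τ s := by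
      rw [eventually_nhdsWithin_iff] at hev
      exact hev.filter_mono nhdsWithin_le_nhds
    filter_upwards [hev', hmem] with τ hτ hτm
    exact hmax _ _ ⟨⟨hτm, hs⟩, (hτ hτm).le⟩

/-! ### Gradient bound -/

namespace RadialFlow

variable {n : ℕ} {a b T : ℝ} {ρ r1 r2 r3 r4 rt rt1 rt2 : ℝ → ℝ → ℝ} {h : ℝ → ℝ}

theorem rt1_eq (hR : RadialFlow n a b T ρ r1 r2 r3 r4 rt rt1 rt2 h) (hab : a < b) {t s : ℝ}
    (ht : t ∈ Ioo 0 T) (hs : s ∈ Icc a b) :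
    rt1 t s = r3 t s / (1 + r1 t s ^ 2) - 2 * r1 t s * r2 t s ^ 2 / (1 + r1 t s ^ 2) ^ 2 +
      (n - 1) * r1 t s / ρ t s ^ 2 + h t * (r1 t s * r2 t s / √(1 + r1 t s ^ 2)) := by
  have hV : 1 + r1 t s ^ 2 ≠ 0 := by positivity
  have hp := (hR.pos t ht s hs).ne'
  have hd := ((((hR.ds2 t ht s hs).fun_div (((hR.ds1 t ht s hs).fun_pow 2).const_add 1) hV).fun_sub
    ((hasDerivWithinAt_const s (Icc a b) ((n : ℝ) - 1)).fun_div (hR.ds0 t ht s hs) hp)).fun_add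
    ((hasDerivWithinAt_sqrt_one_add_sq (hR.ds1 t ht s hs)).const_mul (h t))).congr
    (hR.pde t ht) (hR.pde t ht s hs)
  rw [(uniqueDiffOn_Icc hab s hs).eq_deriv _ (hR.dst0 t ht s hs) hd]
  simp only [Nat.cast_ofNat, Nat.add_one_sub_one, pow_one, zero_mul, zero_sub]
  field_simp
  ring

/-- The product of radius and gradient function is bounded. -/
theorem exists_gradient_bound (hR : RadialFlow n a b T ρ r1 r2 r3 r4 rt rt1 rt2 h) (hn : 2 ≤ n)
    (hab : a < b) {t₀ : ℝ} (ht₀ : t₀ ∈ Ioo 0 T) :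
    ∃ C, ∀ t ∈ Ico t₀ T, ∀ s ∈ Icc a b, ρ t s * √(1 + r1 t s ^ 2) ≤ C := by
  obtain ⟨B, B', C, hB, hB', hC⟩ := hR.exists_barrier hn hab ht₀
  have cS0 := hR.contS0 ht₀
  have cS1 := hR.contS1 ht₀
  obtain ⟨m, hm⟩ := isCompact_Icc.bddAbove_image
    (show ContinuousOn (fun s => ρ t₀ s * √(1 + r1 t₀ s ^ 2)) (Icc a b) by fun_prop)
  -- m bounds ρ v at time t₀; subtracting B and adding it back costs at most C each time.
  refine ⟨m + 2 * C, fun t' ht' s' hs' => ?_⟩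
  have hsub : Icc t₀ t' ×ˢ Icc a b ⊆ dom a b T := fun z hz =>
    ⟨⟨ht₀.1.trans_le hz.1.1, hz.1.2.trans_lt ht'.2⟩, hz.2⟩
  have hBc : ContinuousOn B (Ioo 0 T) := fun t ht => (hB t ht).continuousAt.continuousWithinAt
  have hBc2 : ContinuousOn (fun z : ℝ × ℝ => B z.1) (dom a b T) :=
    hBc.comp continuous_fst.continuousOn (fun z hz => hz.1)
  have hc0 := hR.cont0
  have hc1 := hR.cont1
  have hfc : ContinuousOn (fun z : ℝ × ℝ => ρ z.1 z.2 * √(1 + r1 z.1 z.2 ^ 2) - B z.1)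
    (dom a b T) :=
    (show ContinuousOn (fun z : ℝ × ℝ => ρ z.1 z.2 * √(1 + r1 z.1 z.2 ^ 2)) (dom a b T) by
      fun_prop).sub hBc2
  obtain ⟨t, ht, s, hs, -, hle, hcond⟩ := exists_maximum_point
    (f := fun t s => ρ t s * √(1 + r1 t s ^ 2) - B t) (c := fun _ _ => 1)
    (continuousOn_const) (hfc.mono fun z hz => hsub hz.1) (right_mem_Icc.2 ht'.1) hs' zero_le_one
  have htT : t ∈ Ico t₀ T := ⟨ht.1, ht.2.trans_lt ht'.2⟩
  have ht0 : t ∈ Ioo 0 T := ⟨ht₀.1.trans_le ht.1, htT.2⟩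
  rcases ht.1.eq_or_lt with heq | hlt
  · subst heq
    have h1 := hm (mem_image_of_mem _ hs)
    have h2 := abs_le.1 (hC _ htT)
    have h3 := abs_le.1 (hC _ ht')
    linarith
  exfalso
  obtain ⟨hloc, hpast⟩ := hcond hlt one_pos
  have hN := hR.neumann t ht0
  have hp := hR.pos t ht0 s hs
  obtain ⟨hu1, hu2⟩ := deriv_conditions_of_isLocalMaxOn_Icc
    (g₁ := fun s => r1 t s * √(1 + r1 t s ^ 2) +
      ρ t s * (r1 t s * r2 t s / √(1 + r1 t s ^ 2)))
    (c := r2 t s * √(1 + r1 t s ^ 2) + 2 * r1 t s ^ 2 * r2 t s / √(1 + r1 t s ^ 2) +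
      ρ t s * r2 t s ^ 2 / √(1 + r1 t s ^ 2) ^ 3 + ρ t s * r1 t s * r3 t s / √(1 + r1 t s ^ 2))
    hab hs hloc
    (eventually_nhdsWithin_of_forall fun σ hσ => ((hR.ds0 t ht0 σ hσ).fun_mul
      (hasDerivWithinAt_sqrt_one_add_sq (hR.ds1 t ht0 σ hσ))).sub_const (B t))
    (by
      have hd1 := hR.ds1 t ht0 s hs
      have hv := hasDerivWithinAt_sqrt_one_add_sq hd1
      refine ((hd1.fun_mul hv).fun_add ((hR.ds0 t ht0 s hs).fun_mul
        ((hd1.fun_mul (hR.ds2 t ht0 s hs)).fun_div hv (sqrt_one_add_sq_pos _).ne'))).congr_deriv ?_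
      have hv := sqrt_one_add_sq_pos (r1 t s)
      have hv2 := sq_sqrt_one_add_sq (r1 t s)
      generalize √(1 + r1 t s ^ 2) = v at *
      have : r1 t s ^ 2 = v ^ 2 - 1 := by linarith
      field_simp
      rw [this]
      ring)
    (by rintro (rfl | rfl) <;> simp [hN])
  have hut := deriv_nonneg_of_eventually_le_left
    (((hR.dt0 t ht0 s hs).fun_mul (hasDerivAt_sqrt_one_add_sq (hR.dt1 t ht0 s hs))).fun_sub
      (hB t ht0)) hpast
  have hBt := hB' t htT
  have hpde := hR.pde t ht0 s hs
  have hrt1 := hR.rt1_eq hab ht0 hs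
  have hn1 : (2 : ℝ) ≤ n := by exact_mod_cast hn
  -- This contradicts the maximum: h ≤ h² + 1/4 < h² + 1 ≤ B'.
  suffices hmain : rt t s * √(1 + r1 t s ^ 2) +
      ρ t s * (r1 t s * rt1 t s / √(1 + r1 t s ^ 2)) ≤ h t by
    nlinarith [sq_nonneg (h t - 1 / 2)]
  have hv := sqrt_one_add_sq_pos (r1 t s)
  have hv2 := sq_sqrt_one_add_sq (r1 t s)
  rw [hpde, hrt1]
  rw [← hv2]
  rw [Real.sqrt_sq hv.le]
  generalize √(1 + r1 t s ^ 2) = v at *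
  generalize r1 t s = w at *
  generalize r2 t s = q at *
  generalize r3 t s = q' at *
  generalize ρ t s = r at *
  generalize h t = k at *
  -- The first derivative of u = ρ v is a multiple of w (v² + r q), so a critical point is of one of
  -- two kinds.
  have hcase : w = 0 ∨ r * q = -v ^ 2 := by
    have : w * (v ^ 2 + r * q) = 0 := by
      have := congrArg (· * v) hu1
      field_simp at this
      simpa [mul_comm] using this
    rcases mul_eq_zero.1 this with h0 | h0
    · exact Or.inl h0
    · right; linarith
  rcases hcase with rfl | hq
  · have hv1 : v = 1 := by nlinarith
    subst hv1
    simp only [ne_eq, OfNat.ofNat_ne_zero, not_false_eq_true, zero_pow, mul_zero, zero_mul,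
      zero_div, add_zero, one_pow, div_one, mul_one] at hu2 ⊢
    have h1 : 0 ≤ r * q ^ 2 := by positivity
    have h2 : 0 ≤ ((n : ℝ) - 1) / r := div_nonneg (by linarith) hp.le
    linarith
  · have hq' : q = -v ^ 2 / r := by field_simp; linarith
    subst hq'
    -- In the case r q = -v² this reads u_t = u_ss/v² - n/(r v) + h, where u = ρ v.
    have hid : ((-v ^ 2 / r) / v ^ 2 - (n - 1) / r + k * v) * v +
        r * (w * (q' / v ^ 2 - 2 * w * (-v ^ 2 / r) ^ 2 / (v ^ 2) ^ 2 +
          (n - 1) * w / r ^ 2 + k * (w * (-v ^ 2 / r) / v)) / v) =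
        (-v ^ 2 / r * v + 2 * w ^ 2 * (-v ^ 2 / r) / v + r * (-v ^ 2 / r) ^ 2 / v ^ 3 +
          r * w * q' / v) / v ^ 2 - n / (r * v) + k := by
      have : w ^ 2 = v ^ 2 - 1 := by linarith
      field_simp
      rw [this]
      linear_combination (v ^ 2 * n - 3 * v ^ 2 - v ^ 3 * r * k) * this
    rw [hid]
    have h1 : 0 ≤ (n : ℝ) / (r * v) := by positivity
    have h2 := div_nonpos_of_nonpos_of_nonneg hu2 (sq_nonneg v)
    linarith

end RadialFlow

/-! ### Pointwise algebra of the curvature quantity -/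

/-- The pointwise form of the evolution of `Q P / E` at a spatial critical point; `Q₁`, `Q₂` stand
for the spatial derivatives of `Q`. -/
theorem curvature_evolution_identity {r w Q Q₁ Q₂ P G k v N : ℝ} (hr : r ≠ 0) (hP : P ≠ 0)
    (hG : Q₁ * P + Q * w + G * (2 * w * ((1 + w ^ 2) * Q)) = 0) :
    (Q₂ + N * ((1 + w ^ 2) * Q) / r ^ 2 - 2 * N * w ^ 2 / r ^ 3 +
        k * (v * ((1 + w ^ 2) * Q ^ 2) + v * w ^ 2 * Q ^ 2 + w * v * Q₁) -
        2 * w * Q * (Q₁ + N * w / r ^ 2 + k * (w * v * Q))) * P +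
      (1 + w ^ 2) * Q * (Q - N / r + k * v) +
      G * (2 * w * (Q₁ + N * w / r ^ 2 + k * (w * v * Q))) * (1 + w ^ 2) =
    (Q₂ * P + 2 * Q₁ * w + Q * ((1 + w ^ 2) * Q) + 2 * G * (((1 + w ^ 2) * Q) ^ 2 +
        w * ((1 + w ^ 2) * Q₁ + 2 * w * (1 + w ^ 2) * Q ^ 2))) +
      (-2 * (1 + w ^ 2) ^ 2 * Q ^ 2 * G + 4 * w ^ 2 * (1 + w ^ 2) * Q * G / P +
        2 * w ^ 2 * Q / P + 2 * w ^ 2 * Q ^ 2 + k * v * Q ^ 2 * P + k * v * Q +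
        N * (1 - w ^ 2) * Q * P / r ^ 2 - 2 * N * w ^ 2 * P / r ^ 3 -
        N * (1 + w ^ 2) * Q / r + 2 * N * G * (1 + w ^ 2) * w ^ 2 / r ^ 2) := by
  have hQ : Q₁ = -(Q * w + G * (2 * w * ((1 + w ^ 2) * Q))) / P := by
    field_simp; linarith
  rw [hQ]
  field_simp
  ring

-- The term -2(1 + w²)²Q²G is at least 2Q² in size relative to G. One Q² absorbs the terms without
-- k, once |G| exceeds the threshold; the other absorbs those linear in k by Young's inequality,
-- leaving 4κ⁴k²G².
set_option maxHeartbeats 2000000 in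
theorem curvature_reaction_le {r w Q P E G k v N κ ε R : ℝ} (hN : 1 ≤ N) (hε : 0 < ε) (hr : ε ≤ r)
    (hP : 0 < P) (hPr : P ≤ r) (hPR : P ≤ R) (hGE : G * E = Q * P) (hv1 : 1 ≤ v)
    (hv : v ^ 2 = 1 + w ^ 2) (hκ : v ^ 2 ≤ κ) (hE : κ ≤ E) (hE2 : E ≤ 2 * κ)
    (hG : 1 + 12 * κ ^ 2 + 8 * N * κ ^ 2 * R ^ 2 / ε ^ 2 ≤ |G|) :
    G * (-2 * (1 + w ^ 2) ^ 2 * Q ^ 2 * G + 4 * w ^ 2 * (1 + w ^ 2) * Q * G / P +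
        2 * w ^ 2 * Q / P + 2 * w ^ 2 * Q ^ 2 + k * v * Q ^ 2 * P + k * v * Q +
        N * (1 - w ^ 2) * Q * P / r ^ 2 - 2 * N * w ^ 2 * P / r ^ 3 -
        N * (1 + w ^ 2) * Q / r + 2 * N * G * (1 + w ^ 2) * w ^ 2 / r ^ 2) ≤
      4 * κ ^ 4 * k ^ 2 * G ^ 2 := by
  set M := 1 + 12 * κ ^ 2 + 8 * N * κ ^ 2 * R ^ 2 / ε ^ 2 with hM
  have hr0 : 0 < r := hε.trans_le hr
  have hv0 : 0 < v := by linarith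
  have hw0 : 0 ≤ w ^ 2 := sq_nonneg w
  have hκ1 : 1 ≤ κ := (one_le_pow₀ hv1).trans hκ
  have hwκ : w ^ 2 ≤ κ := by linarith
  have hvκ : v ≤ κ := (le_self_pow₀ hv1 two_ne_zero).trans hκ
  have hκ2 : κ ≤ κ ^ 2 := le_self_pow₀ hκ1 two_ne_zero
  have hE0 : 0 < E := by linarith
  have hM1 : 1 ≤ M := by
    have : 0 ≤ 12 * κ ^ 2 + 8 * N * κ ^ 2 * R ^ 2 / ε ^ 2 := by positivity
    linarith
  have hM0 : 0 < M := by linarith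
  have hg1 : 1 ≤ |G| := hM1.trans hG
  have hR0 : 0 < R := hP.trans_le hPR
  set q := |Q| with hq
  set i := P⁻¹ with hi
  have hi0 : 0 < i := inv_pos.2 hP
  have hPi : P * i = 1 := mul_inv_cancel₀ hP.ne'
  have hq0 : 0 ≤ q := abs_nonneg _
  have habs : |G| * E = q * P := by
    have := congrArg abs hGE
    rwa [abs_mul, abs_mul, abs_of_pos hE0, abs_of_pos hP] at this
  have hQi : Q = G * E * i := by rw [hGE, mul_assoc, hPi, mul_one]
  -- Since |G| E = |Q| P with E ≥ 1, a large G forces |Q| to be large compared with 1/P, and hence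
  -- compared with 1/R. This makes the remaining terms small relative to Q².
  have hMq : M * i ≤ q := by
    have h1 : M * 1 ≤ |G| * E := mul_le_mul hG (hκ1.trans hE) zero_le_one (abs_nonneg _)
    rw [habs, mul_one] at h1
    calc M * i ≤ q * P * i := mul_le_mul_of_nonneg_right h1 hi0.le
      _ = q := by rw [mul_assoc, hPi, mul_one]
  have hMR : M ≤ q * R := by
    have h1 : M * 1 ≤ |G| * E := mul_le_mul hG (hκ1.trans hE) zero_le_one (abs_nonneg _)
    rw [habs, mul_one] at h1
    exact h1.trans (mul_le_mul_of_nonneg_left hPR hq0)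
  have hG2 : G ^ 2 = |G| ^ 2 := (sq_abs G).symm
  have hQ2 : Q ^ 2 = q ^ 2 := (sq_abs Q).symm
  have hQq : Q ≤ q := le_abs_self _
  have hkabs : k ≤ |k| := le_abs_self k
  -- estimates of the single terms, relative to `G²`
  have hqM : i ≤ q / M := by rw [le_div_iff₀ hM0]; linarith
  have hone : 1 ≤ q ^ 2 * R ^ 2 / M := by
    rw [le_div_iff₀ hM0, one_mul]
    calc M ≤ M * M := le_mul_of_one_le_left hM0.le hM1
      _ ≤ (q * R) * (q * R) := mul_le_mul hMR hMR hM0.le (by positivity)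
      _ = _ := by ring
  have hiq : i ≤ q := hqM.trans (div_le_self hq0 hM1)
  have hir : 1 / r ^ 2 ≤ 1 / ε ^ 2 := by gcongr
  have t1 : 4 * w ^ 2 * (1 + w ^ 2) * Q * i ≤ 4 * κ ^ 2 * (q ^ 2 / M) := by
    calc 4 * w ^ 2 * (1 + w ^ 2) * Q * i ≤ 4 * w ^ 2 * (1 + w ^ 2) * q * i := by gcongr
      _ ≤ 4 * κ * κ * q * (q / M) := by gcongr; linarith
      _ = _ := by ring
  have t2 : 2 * w ^ 2 * E * i ^ 2 ≤ 4 * κ ^ 2 * (q ^ 2 / M) := by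
    calc 2 * w ^ 2 * E * i ^ 2 = 2 * w ^ 2 * E * i * i := by ring
      _ ≤ 2 * κ * (2 * κ) * q * (q / M) := by gcongr
      _ = _ := by ring
  have t3 : 2 * w ^ 2 * E * i * Q ≤ 4 * κ ^ 2 * (q ^ 2 / M) := by
    calc 2 * w ^ 2 * E * i * Q ≤ 2 * w ^ 2 * E * i * q := by gcongr
      _ ≤ 2 * κ * (2 * κ) * (q / M) * q := by gcongr
      _ = _ := by ring
  have t4 : k * v * E * Q ≤ 2 * κ ^ 2 * (|k| * q) := by
    calc k * v * E * Q ≤ |k * v * E * Q| := le_abs_self _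
      _ = |k| * v * E * q := by rw [abs_mul, abs_mul, abs_mul, abs_of_pos hv0, abs_of_pos hE0]
      _ ≤ |k| * κ * (2 * κ) * q := by gcongr
      _ = _ := by ring
  have t5 : k * v * E * i ≤ 2 * κ ^ 2 * (|k| * q) := by
    calc k * v * E * i ≤ |k| * v * E * i := by gcongr
      _ ≤ |k| * κ * (2 * κ) * q := by gcongr
      _ = _ := by ring
  have t6 : N * (1 - w ^ 2) * E / r ^ 2 ≤ 2 * N * κ ^ 2 * (q ^ 2 * R ^ 2 / M) / ε ^ 2 := by
    calc N * (1 - w ^ 2) * E / r ^ 2 = N * (1 - w ^ 2) * E * (1 / r ^ 2) := by ring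
      _ ≤ N * κ * (2 * κ) * (1 / ε ^ 2) := by gcongr; linarith
      _ = 2 * N * κ ^ 2 * 1 / ε ^ 2 := by ring
      _ ≤ _ := by gcongr
  have t7 : 2 * N * (1 + w ^ 2) * w ^ 2 / r ^ 2 ≤
      2 * N * κ ^ 2 * (q ^ 2 * R ^ 2 / M) / ε ^ 2 := by
    calc 2 * N * (1 + w ^ 2) * w ^ 2 / r ^ 2 = 2 * N * (1 + w ^ 2) * w ^ 2 * (1 / r ^ 2) := by ring
      _ ≤ 2 * N * κ * κ * (1 / ε ^ 2) := by gcongr; linarith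
      _ = 2 * N * κ ^ 2 * 1 / ε ^ 2 := by ring
      _ ≤ _ := by gcongr
  have t8 : -(G * (2 * N * w ^ 2 * P / r ^ 3)) ≤
      G ^ 2 * (2 * N * κ ^ 2 * (q ^ 2 * R ^ 2 / M) / ε ^ 2) := by
    have h1 : 2 * N * w ^ 2 * P / r ^ 3 ≤ 2 * N * κ ^ 2 * (q ^ 2 * R ^ 2 / M) / ε ^ 2 := by
      calc 2 * N * w ^ 2 * P / r ^ 3 ≤ 2 * N * w ^ 2 * r / r ^ 3 := by gcongr
        _ = 2 * N * w ^ 2 * (1 / r ^ 2) := by field_simp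
        _ ≤ 2 * N * κ ^ 2 * (1 / r ^ 2) :=
          mul_le_mul_of_nonneg_right (mul_le_mul_of_nonneg_left (hwκ.trans hκ2) (by positivity))
            (by positivity)
        _ ≤ 2 * N * κ ^ 2 * (1 / ε ^ 2) := by gcongr
        _ = 2 * N * κ ^ 2 * 1 / ε ^ 2 := by ring
        _ ≤ _ := by gcongr
    have h2 : 0 ≤ 2 * N * w ^ 2 * P / r ^ 3 := by positivity
    calc -(G * (2 * N * w ^ 2 * P / r ^ 3)) ≤ |G| * (2 * N * w ^ 2 * P / r ^ 3) := by
          rw [← neg_mul]; exact mul_le_mul_of_nonneg_right (neg_le_abs G) h2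
      _ ≤ G ^ 2 * (2 * N * w ^ 2 * P / r ^ 3) := by
          refine mul_le_mul_of_nonneg_right ?_ h2
          rw [hG2]; exact le_self_pow₀ hg1 two_ne_zero
      _ ≤ _ := by gcongr
  have t9 : 0 ≤ N * (1 + w ^ 2) * E * i / r := by positivity
  have t0 : q ^ 2 ≤ (1 + w ^ 2) ^ 2 * Q ^ 2 := by
    rw [hQ2]
    exact le_mul_of_one_le_left (sq_nonneg q) (one_le_pow₀ (by linarith))
  -- The factor 12 collects three terms with 4κ² (`t1`, `t2`, `t3`), the factor 6 three with 2Nκ²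
  -- (`t6`, `t7`, `t8`).
  have hcoef : 12 * κ ^ 2 * (q ^ 2 / M) + 6 * N * κ ^ 2 * (q ^ 2 * R ^ 2 / M) / ε ^ 2 ≤ q ^ 2 := by
    have : 12 * κ ^ 2 * (q ^ 2 / M) + 6 * N * κ ^ 2 * (q ^ 2 * R ^ 2 / M) / ε ^ 2 =
        q ^ 2 * ((12 * κ ^ 2 + 6 * N * κ ^ 2 * R ^ 2 / ε ^ 2) / M) := by ring
    rw [this]
    refine mul_le_of_le_one_right (sq_nonneg q) ?_
    rw [div_le_one hM0, hM]
    have : 6 * N * κ ^ 2 * R ^ 2 / ε ^ 2 ≤ 8 * N * κ ^ 2 * R ^ 2 / ε ^ 2 := by gcongr; norm_num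
    linarith
  have hfin : 4 * κ ^ 2 * (|k| * q) ≤ q ^ 2 + 4 * κ ^ 4 * k ^ 2 := by
    rw [← sq_abs k]; linarith [sq_nonneg (q - 2 * κ ^ 2 * |k|)]
  have hexp : G * (-2 * (1 + w ^ 2) ^ 2 * Q ^ 2 * G + 4 * w ^ 2 * (1 + w ^ 2) * Q * G / P +
        2 * w ^ 2 * Q / P + 2 * w ^ 2 * Q ^ 2 + k * v * Q ^ 2 * P + k * v * Q +
        N * (1 - w ^ 2) * Q * P / r ^ 2 - 2 * N * w ^ 2 * P / r ^ 3 -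
        N * (1 + w ^ 2) * Q / r + 2 * N * G * (1 + w ^ 2) * w ^ 2 / r ^ 2) =
      G ^ 2 * (-2 * ((1 + w ^ 2) ^ 2 * Q ^ 2) + 4 * w ^ 2 * (1 + w ^ 2) * Q * i +
        2 * w ^ 2 * E * i ^ 2 + 2 * w ^ 2 * E * i * Q + k * v * E * Q + k * v * E * i +
        N * (1 - w ^ 2) * E / r ^ 2 - N * (1 + w ^ 2) * E * i / r +
        2 * N * (1 + w ^ 2) * w ^ 2 / r ^ 2) - G * (2 * N * w ^ 2 * P / r ^ 3) := by
    have hiP : i = 1 / P := by rw [hi, one_div]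
    rw [hQi, hiP]
    field_simp
    ring
  rw [hexp]
  have hbr : G ^ 2 * (-2 * ((1 + w ^ 2) ^ 2 * Q ^ 2) + 4 * w ^ 2 * (1 + w ^ 2) * Q * i +
        2 * w ^ 2 * E * i ^ 2 + 2 * w ^ 2 * E * i * Q + k * v * E * Q + k * v * E * i +
        N * (1 - w ^ 2) * E / r ^ 2 - N * (1 + w ^ 2) * E * i / r +
        2 * N * (1 + w ^ 2) * w ^ 2 / r ^ 2) ≤
      G ^ 2 * (4 * κ ^ 4 * k ^ 2 - 2 * N * κ ^ 2 * (q ^ 2 * R ^ 2 / M) / ε ^ 2) := by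
    refine mul_le_mul_of_nonneg_left ?_ (sq_nonneg G)
    have e6 : 6 * N * κ ^ 2 * (q ^ 2 * R ^ 2 / M) / ε ^ 2 =
      3 * (2 * N * κ ^ 2 * (q ^ 2 * R ^ 2 / M) / ε ^ 2) := by ring
    rw [e6] at hcoef
    linarith
  linarith

/-- At the maximum, (2κ - w²)(1 + w²) G_t is a sum X + Z: G X has a sign by the second order
condition, and G Z is the reaction term already estimated. The factor in front is at least 1 and can
be dropped where G G_t > 0. -/
theorem curvature_growth_algebra {r w Q Q₁ Q₂ G k v N κ ε R m x0 x1 x2 : ℝ} (hN : 1 ≤ N)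
    (hε : 0 < ε) (hm : 0 < m) (hρ : ε < r) (hR : r ≤ R) (hE : 0 < 2 * κ - w ^ 2)
    (hκ : 1 + w ^ 2 ≤ κ) (hv2 : v ^ 2 = 1 + w ^ 2) (hv1 : 1 ≤ v)
    (hGE : G * (2 * κ - w ^ 2) = Q * (r - ε))
    (hnum : Q₁ * (r - ε) + Q * w + G * (2 * w * ((1 + w ^ 2) * Q)) = 0)
    (hrt : x0 = Q - N / r + k * v)
    (hrt1 : x1 = Q₁ + N * w / r ^ 2 + k * (w * ((1 + w ^ 2) * Q) / v))
    (hrt2 : x2 = Q₂ + N * ((1 + w ^ 2) * Q) / r ^ 2 - 2 * N * w ^ 2 / r ^ 3 +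
      k * ((((1 + w ^ 2) * Q) ^ 2 +
        w * ((1 + w ^ 2) * Q₁ + 2 * w * (1 + w ^ 2) * Q ^ 2)) / v -
        w ^ 2 * ((1 + w ^ 2) * Q) ^ 2 / v ^ 3))
    (hmax : 2 * m / (2 * κ - w ^ 2) * (G * (Q₂ * (r - ε) + 2 * Q₁ * w + Q * ((1 + w ^ 2) * Q) +
      2 * G * (((1 + w ^ 2) * Q) ^ 2 +
        w * ((1 + w ^ 2) * Q₁ + 2 * w * (1 + w ^ 2) * Q ^ 2)))) ≤ 0)
    (hG : 1 + 12 * κ ^ 2 + 8 * N * κ ^ 2 * R ^ 2 / ε ^ 2 ≤ |G|) :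
    G * (((x2 / (1 + w ^ 2) - 2 * w * Q * x1 / (1 + w ^ 2)) * (r - ε) + Q * x0 +
      G * (2 * w * x1)) / (2 * κ - w ^ 2)) ≤ 4 * κ ^ 4 * k ^ 2 * G ^ 2 := by
  have hp : 0 < r := hε.trans hρ
  have hV : (0 : ℝ) < 1 + w ^ 2 := by positivity
  have hP : 0 < r - ε := sub_pos.2 hρ
  have e1 : x1 = Q₁ + N * w / r ^ 2 + k * (w * v * Q) := by
    rw [hrt1, ← hv2]; field_simp
  have e2 : x2 = Q₂ + N * ((1 + w ^ 2) * Q) / r ^ 2 - 2 * N * w ^ 2 / r ^ 3 +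
      k * (v * ((1 + w ^ 2) * Q ^ 2) + v * w ^ 2 * Q ^ 2 + w * v * Q₁) := by
    rw [hrt2, ← hv2]; field_simp; ring
  have hid := curvature_evolution_identity (r := r) (Q₂ := Q₂) (k := k) (v := v) (N := N) hp.ne'
    hP.ne' hnum
  have hle := curvature_reaction_le (w := w) (k := k) (R := R) hN hε hρ.le hP (by linarith)
    (by linarith) hGE hv1 hv2 (by linarith) (by linarith) (by linarith [sq_nonneg w]) hG
  rw [← e1, ← e2, ← hrt] at hid
  generalize -2 * (1 + w ^ 2) ^ 2 * Q ^ 2 * G + 4 * w ^ 2 * (1 + w ^ 2) * Q * G / (r - ε) +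
        2 * w ^ 2 * Q / (r - ε) + 2 * w ^ 2 * Q ^ 2 + k * v * Q ^ 2 * (r - ε) + k * v * Q +
        N * (1 - w ^ 2) * Q * (r - ε) / r ^ 2 - 2 * N * w ^ 2 * (r - ε) / r ^ 3 -
        N * (1 + w ^ 2) * Q / r + 2 * N * G * (1 + w ^ 2) * w ^ 2 / r ^ 2 = Z at hid hle
  set X := Q₂ * (r - ε) + 2 * Q₁ * w + Q * ((1 + w ^ 2) * Q) + 2 * G * (((1 + w ^ 2) * Q) ^ 2 +
        w * ((1 + w ^ 2) * Q₁ + 2 * w * (1 + w ^ 2) * Q ^ 2)) with hX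
  have hGX : G * X ≤ 0 := nonpos_of_mul_nonpos_right hmax (by positivity)
  set Y := G * (((x2 / (1 + w ^ 2) - 2 * w * Q * x1 / (1 + w ^ 2)) * (r - ε) + Q * x0 +
    G * (2 * w * x1)) / (2 * κ - w ^ 2)) with hY
  have hYle : Y * ((2 * κ - w ^ 2) * (1 + w ^ 2)) ≤ 4 * κ ^ 4 * k ^ 2 * G ^ 2 := by
    have : Y * ((2 * κ - w ^ 2) * (1 + w ^ 2)) = G * (X + Z) := by
      rw [← hid, hY]
      field_simp
    rw [this, mul_add]
    linarith
  have hfac : 1 ≤ (2 * κ - w ^ 2) * (1 + w ^ 2) := by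
    have h1 : 1 ≤ 2 * κ - w ^ 2 := by linarith [sq_nonneg w]
    have h2 : 1 ≤ 1 + w ^ 2 := by linarith [sq_nonneg w]
    exact one_le_mul_of_one_le_of_one_le h1 h2
  rcases le_or_gt Y 0 with h0 | h0
  · exact h0.trans (by positivity)
  · exact (le_mul_of_one_le_right h0.le hfac).trans hYle

/-! ### Curvature of the profile away from the axis -/

namespace RadialFlow

variable {n : ℕ} {a b T : ℝ} {ρ r1 r2 r3 r4 rt rt1 rt2 : ℝ → ℝ → ℝ} {h : ℝ → ℝ}

/-- The Neumann condition holds for all times, so ∂ₜρ' = 0 at the ends, and the differentiated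
equation then leaves only ρ'''. Hence Q and G satisfy Neumann conditions too. -/
theorem r3_eq_zero (hR : RadialFlow n a b T ρ r1 r2 r3 r4 rt rt1 rt2 h) (hab : a < b) {t s : ℝ}
    (ht : t ∈ Ioo 0 T) (hs : s = a ∨ s = b) : r1 t s = 0 ∧ r3 t s = 0 := by
  have hsm : s ∈ Icc a b := by
    rcases hs with rfl | rfl
    · exact left_mem_Icc.2 hab.le
    · exact right_mem_Icc.2 hab.le
  have h0 : ∀ τ ∈ Ioo 0 T, r1 τ s = 0 := fun τ hτ => by
    rcases hs with rfl | rfl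
    · exact (hR.neumann τ hτ).1
    · exact (hR.neumann τ hτ).2
  have h1 : HasDerivAt (fun τ => r1 τ s) 0 t :=
    (hasDerivAt_const t (0 : ℝ)).congr_of_eventuallyEq
      (by filter_upwards [isOpen_Ioo.mem_nhds ht] with τ hτ using h0 τ hτ)
  have h2 := hR.rt1_eq hab ht hsm
  rw [(hR.dt1 t ht s hsm).unique h1, h0 t ht] at h2
  refine ⟨h0 t ht, ?_⟩
  simpa using h2.symm

theorem hasDerivWithinAt_Q (hR : RadialFlow n a b T ρ r1 r2 r3 r4 rt rt1 rt2 h) {t s : ℝ}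
    (ht : t ∈ Ioo 0 T) (hs : s ∈ Icc a b) :
    HasDerivWithinAt (fun σ => r2 t σ / (1 + r1 t σ ^ 2))
      (r3 t s / (1 + r1 t s ^ 2) - 2 * r1 t s * r2 t s ^ 2 / (1 + r1 t s ^ 2) ^ 2)
      (Icc a b) s := by
  have hV : 1 + r1 t s ^ 2 ≠ 0 := by positivity
  refine ((hR.ds2 t ht s hs).fun_div (((hR.ds1 t ht s hs).fun_pow 2).const_add 1)
    hV).congr_deriv ?_
  simp only [Nat.cast_ofNat, Nat.add_one_sub_one, pow_one]
  field_simp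

/-- No formula for Q₂ = Q'' is needed: it occurs in the time derivative and in the second order
condition at the maximum, and is eliminated between them. -/
theorem exists_hasDerivWithinAt_Q1 (hR : RadialFlow n a b T ρ r1 r2 r3 r4 rt rt1 rt2 h)
    (hab : a < b) {t s : ℝ} (ht : t ∈ Ioo 0 T) (hs : s ∈ Icc a b) :
    ∃ Q₂, HasDerivWithinAt (fun σ => r3 t σ / (1 + r1 t σ ^ 2) -
        2 * r1 t σ * r2 t σ ^ 2 / (1 + r1 t σ ^ 2) ^ 2) Q₂ (Icc a b) s ∧
      rt2 t s = Q₂ + (n - 1) * r2 t s / ρ t s ^ 2 - 2 * (n - 1) * r1 t s ^ 2 / ρ t s ^ 3 +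
        h t * ((r2 t s ^ 2 + r1 t s * r3 t s) / √(1 + r1 t s ^ 2) -
          r1 t s ^ 2 * r2 t s ^ 2 / √(1 + r1 t s ^ 2) ^ 3) := by
  have hV : 1 + r1 t s ^ 2 ≠ 0 := by positivity
  have hp := (hR.pos t ht s hs).ne'
  have d0 := hR.ds0 t ht s hs
  have d1 := hR.ds1 t ht s hs
  have d2 := hR.ds2 t ht s hs
  have hQ1 := ((hR.ds3 t ht s hs).fun_div ((d1.fun_pow 2).const_add 1) hV).fun_sub
    (((d1.const_mul 2).fun_mul (d2.fun_pow 2)).fun_div (((d1.fun_pow 2).const_add 1).fun_pow 2)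
      (pow_ne_zero 2 hV))
  refine ⟨_, hQ1, ?_⟩
  have hd := ((hQ1.fun_add ((d1.const_mul ((n : ℝ) - 1)).fun_div (d0.fun_pow 2)
    (pow_ne_zero 2 hp))).fun_add (((d1.fun_mul d2).fun_div (hasDerivWithinAt_sqrt_one_add_sq d1)
      (sqrt_one_add_sq_pos _).ne').const_mul (h t))).congr
    (fun σ hσ => hR.rt1_eq hab ht hσ) (hR.rt1_eq hab ht hs)
  rw [(uniqueDiffOn_Icc hab s hs).eq_deriv _ (hR.dst1 t ht s hs) hd, add_sub_assoc, add_assoc,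
    add_assoc]
  congr 1
  have hv := sqrt_one_add_sq_pos (r1 t s)
  generalize √(1 + r1 t s ^ 2) = v at *
  simp only [Nat.cast_ofNat, Nat.add_one_sub_one, pow_one]
  field_simp

/-- G is kept as a factor in the numerator, so that at a critical point the numerator vanishes and
differentiating the quotient again produces only one term. -/
theorem hasDerivWithinAt_G (hR : RadialFlow n a b T ρ r1 r2 r3 r4 rt rt1 rt2 h) {t s ε K : ℝ}
    (ht : t ∈ Ioo 0 T) (hs : s ∈ Icc a b) (hE : K - r1 t s ^ 2 ≠ 0) :
    HasDerivWithinAt (fun σ => r2 t σ / (1 + r1 t σ ^ 2) * (ρ t σ - ε) / (K - r1 t σ ^ 2))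
      (((r3 t s / (1 + r1 t s ^ 2) - 2 * r1 t s * r2 t s ^ 2 / (1 + r1 t s ^ 2) ^ 2) *
          (ρ t s - ε) + r2 t s / (1 + r1 t s ^ 2) * r1 t s +
          r2 t s / (1 + r1 t s ^ 2) * (ρ t s - ε) / (K - r1 t s ^ 2) * (2 * r1 t s * r2 t s)) /
        (K - r1 t s ^ 2)) (Icc a b) s := by
  refine (((hR.hasDerivWithinAt_Q ht hs).fun_mul ((hR.ds0 t ht s hs).sub_const ε)).fun_div
    (((hR.ds1 t ht s hs).fun_pow 2).const_sub K) hE).congr_deriv ?_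
  simp only [Nat.cast_ofNat, Nat.add_one_sub_one, pow_one]
  generalize r3 t s / (1 + r1 t s ^ 2) - 2 * r1 t s * r2 t s ^ 2 / (1 + r1 t s ^ 2) ^ 2 = Q₁
  generalize r2 t s / (1 + r1 t s ^ 2) = Q
  field_simp
  ring

theorem hasDerivAt_G (hR : RadialFlow n a b T ρ r1 r2 r3 r4 rt rt1 rt2 h) {t s ε K : ℝ}
    (ht : t ∈ Ioo 0 T) (hs : s ∈ Icc a b) (hE : K - r1 t s ^ 2 ≠ 0) :
    HasDerivAt (fun τ => r2 τ s / (1 + r1 τ s ^ 2) * (ρ τ s - ε) / (K - r1 τ s ^ 2))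
      (((rt2 t s / (1 + r1 t s ^ 2) - 2 * r1 t s * (r2 t s / (1 + r1 t s ^ 2)) * rt1 t s /
          (1 + r1 t s ^ 2)) * (ρ t s - ε) + r2 t s / (1 + r1 t s ^ 2) * rt t s +
          r2 t s / (1 + r1 t s ^ 2) * (ρ t s - ε) / (K - r1 t s ^ 2) * (2 * r1 t s * rt1 t s)) /
        (K - r1 t s ^ 2)) t := by
  have hV : 1 + r1 t s ^ 2 ≠ 0 := by positivity
  have d1 := hR.dt1 t ht s hs
  refine ((((hR.dt2 t ht s hs).fun_div ((d1.fun_pow 2).const_add 1) hV).fun_mul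
    ((hR.dt0 t ht s hs).sub_const ε)).fun_div ((d1.fun_pow 2).const_sub K) hE).congr_deriv ?_
  simp only [Nat.cast_ofNat, Nat.add_one_sub_one, pow_one]
  field_simp
  ring

/-- At a local maximum of `G²` in space with `G` large, `G = Q (ρ - ε) / (K - ρ'²)`, the growth rate
of `G²` is controlled by the square of the averaged mean curvature. -/
theorem curvature_growth_le (hR : RadialFlow n a b T ρ r1 r2 r3 r4 rt rt1 rt2 h) (hn : 2 ≤ n)
    (hab : a < b) {t s ε κ R m : ℝ} (ht : t ∈ Ioo 0 T) (hs : s ∈ Icc a b) (hε : 0 < ε) (hm : 0 < m)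
    (hκ : ∀ σ ∈ Icc a b, ε ≤ ρ t σ → 1 + r1 t σ ^ 2 ≤ κ) (hRs : ρ t s ≤ R) (hρ : ε < ρ t s)
    (hloc : IsLocalMaxOn (fun σ =>
      (r2 t σ / (1 + r1 t σ ^ 2) * (ρ t σ - ε) / (2 * κ - r1 t σ ^ 2)) ^ 2 * m) (Icc a b) s)
    (hG : 1 + 12 * κ ^ 2 + 8 * (n - 1) * κ ^ 2 * R ^ 2 / ε ^ 2 ≤
      |r2 t s / (1 + r1 t s ^ 2) * (ρ t s - ε) / (2 * κ - r1 t s ^ 2)|) :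
    r2 t s / (1 + r1 t s ^ 2) * (ρ t s - ε) / (2 * κ - r1 t s ^ 2) *
      (((rt2 t s / (1 + r1 t s ^ 2) - 2 * r1 t s * (r2 t s / (1 + r1 t s ^ 2)) * rt1 t s /
          (1 + r1 t s ^ 2)) * (ρ t s - ε) + r2 t s / (1 + r1 t s ^ 2) * rt t s +
          r2 t s / (1 + r1 t s ^ 2) * (ρ t s - ε) / (2 * κ - r1 t s ^ 2) *
            (2 * r1 t s * rt1 t s)) / (2 * κ - r1 t s ^ 2)) ≤
      4 * κ ^ 4 * h t ^ 2 *
        (r2 t s / (1 + r1 t s ^ 2) * (ρ t s - ε) / (2 * κ - r1 t s ^ 2)) ^ 2 := by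
  obtain ⟨Q₂, hQ₂, hrt2⟩ := hR.exists_hasDerivWithinAt_Q1 hab ht hs
  have hrt1 := hR.rt1_eq hab ht hs
  have hrt := hR.pde t ht s hs
  have hEpos : ∀ σ ∈ Icc a b, ε ≤ ρ t σ → 0 < 2 * κ - r1 t σ ^ 2 := fun σ hσ hle => by
    have := hκ σ hσ hle
    nlinarith [sq_nonneg (r1 t σ)]
  have hnear : ∀ᶠ σ in 𝓝[Icc a b] s, ε < ρ t σ :=
    (hR.contS0 ht s hs).eventually (lt_mem_nhds hρ)
  have hE := hEpos s hs hρ.le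
  set Qf := fun σ => r2 t σ / (1 + r1 t σ ^ 2) with hQf
  set Q₁f := fun σ => r3 t σ / (1 + r1 t σ ^ 2) -
        2 * r1 t σ * r2 t σ ^ 2 / (1 + r1 t σ ^ 2) ^ 2 with hQ₁f
  set Gf := fun σ => Qf σ * (ρ t σ - ε) / (2 * κ - r1 t σ ^ 2) with hGf
  set G₁f := fun σ => (Q₁f σ * (ρ t σ - ε) + Qf σ * r1 t σ + Gf σ * (2 * r1 t σ * r2 t σ)) /
    (2 * κ - r1 t σ ^ 2) with hG₁f
  have hdG : ∀ σ ∈ Icc a b, ε ≤ ρ t σ → HasDerivWithinAt Gf (G₁f σ) (Icc a b) σ :=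
    fun σ hσ hle => hR.hasDerivWithinAt_G ht hσ (hEpos σ hσ hle).ne'
  have d0 := hR.ds0 t ht s hs
  have d1 := hR.ds1 t ht s hs
  have d2 := hR.ds2 t ht s hs
  have hdG₁ := (((hQ₂.fun_mul (d0.sub_const ε)).fun_add
    ((hR.hasDerivWithinAt_Q ht hs).fun_mul d1)).fun_add
    ((hdG s hs hρ.le).fun_mul ((d1.const_mul 2).fun_mul d2))).fun_div
    ((d1.fun_pow 2).const_sub (2 * κ)) hE.ne'
  -- The positive factor m stands for the weight exp(-cB), which is constant in space and does not
  -- affect the signs.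
  obtain ⟨c1, c2⟩ := deriv_conditions_of_isLocalMaxOn_Icc
    (g₁ := fun σ => 2 * Gf σ * G₁f σ * m) hab hs hloc
    (by
      filter_upwards [hnear, self_mem_nhdsWithin] with σ hσ hmem
      exact (((hdG σ hmem hσ.le).fun_pow 2).mul_const m).congr_deriv (by simp))
    ((((hdG s hs hρ.le).const_mul 2).fun_mul hdG₁).mul_const m)
    (by
      intro hb
      obtain ⟨e1, e3⟩ := hR.r3_eq_zero hab ht hb
      simp [hG₁f, hQ₁f, e1, e3])
  have hGdef : Gf s = Qf s * (ρ t s - ε) / (2 * κ - r1 t s ^ 2) := rfl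
  have hGne : Gf s ≠ 0 := by
    intro h0
    change _ ≤ |Gf s| at hG
    rw [h0, abs_zero] at hG
    have : (0 : ℝ) ≤ n - 1 := by
      have : (2 : ℝ) ≤ n := by exact_mod_cast hn
      linarith
    have : 0 ≤ 12 * κ ^ 2 + 8 * (n - 1) * κ ^ 2 * R ^ 2 / ε ^ 2 := by positivity
    linarith
  have hG₁0 : G₁f s = 0 := by
    have := (mul_eq_zero.1 c1).resolve_right hm.ne'
    exact (mul_eq_zero.1 this).resolve_left (mul_ne_zero two_ne_zero hGne)
  have hnum : Q₁f s * (ρ t s - ε) + Qf s * r1 t s + Gf s * (2 * r1 t s * r2 t s) = 0 :=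
    (div_eq_zero_iff.1 hG₁0).resolve_right hE.ne'
  rw [hnum] at c2
  change _ ≤ |Gf s| at hG
  change Gf s * (((rt2 t s / (1 + r1 t s ^ 2) - 2 * r1 t s * Qf s * rt1 t s /
          (1 + r1 t s ^ 2)) * (ρ t s - ε) + Qf s * rt t s + Gf s *
            (2 * r1 t s * rt1 t s)) / (2 * κ - r1 t s ^ 2)) ≤ 4 * κ ^ 4 * h t ^ 2 * Gf s ^ 2
  change rt1 t s = Q₁f s + _ + _ at hrt1
  change rt t s = Qf s - _ + _ at hrt
  have hv := sqrt_one_add_sq_pos (r1 t s)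
  have hv2 := sq_sqrt_one_add_sq (r1 t s)
  have hv1 := one_le_sqrt_one_add_sq (r1 t s)
  have hκs := hκ s hs hρ.le
  have hGE : Gf s * (2 * κ - r1 t s ^ 2) = Qf s * (ρ t s - ε) := by
    rw [hGdef, div_mul_cancel₀ _ hE.ne']
  have hr2 : r2 t s = (1 + r1 t s ^ 2) * Qf s := by
    simp only [hQf]; field_simp
  have hr3 : r3 t s = (1 + r1 t s ^ 2) * Q₁f s + 2 * r1 t s * (1 + r1 t s ^ 2) * Qf s ^ 2 := by
    simp only [hQ₁f, hQf]; field_simp; ring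
  have hp := hR.pos t ht s hs
  rw [hG₁0] at c2
  rw [hr2] at hrt1 hnum hrt2 c2
  rw [hr3] at hrt2 c2
  have hn1 : (1 : ℝ) ≤ (n : ℝ) - 1 := by
    have : (2 : ℝ) ≤ n := by exact_mod_cast hn
    linarith
  have hmax : 2 * m / (2 * κ - r1 t s ^ 2) * (Gf s * (Q₂ * (ρ t s - ε) + 2 * Q₁f s * r1 t s +
      Qf s * ((1 + r1 t s ^ 2) * Qf s) + 2 * Gf s * (((1 + r1 t s ^ 2) * Qf s) ^ 2 +
        r1 t s * ((1 + r1 t s ^ 2) * Q₁f s +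
          2 * r1 t s * (1 + r1 t s ^ 2) * Qf s ^ 2)))) ≤ 0 := by
    refine le_of_eq_of_le ?_ c2
    clear_value Gf Qf Q₁f
    generalize Gf s = G
    generalize Qf s = Q
    generalize Q₁f s = Q₁
    have hV : 1 + r1 t s ^ 2 ≠ 0 := by positivity
    field_simp
    ring
  exact curvature_growth_algebra hn1 hε hm hρ hRs hE hκs hv2 hv1 hGE hnum hrt hrt1 hrt2 hmax hG

/-- Maximum principle for G² exp(-cB) on {ρ ≥ ε}; the square treats both signs of Q at once. G
vanishes on {ρ = ε}, so a large maximum lies off that edge, and the decay of the weight beats the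
growth rate proportional to h². -/
theorem exists_cutoff_curvature_bound (hR : RadialFlow n a b T ρ r1 r2 r3 r4 rt rt1 rt2 h)
    (hn : 2 ≤ n) (hab : a < b) {t₀ ε : ℝ} (ht₀ : t₀ ∈ Ioo 0 T) (hε : 0 < ε) :
    ∃ C, ∀ t ∈ Ico t₀ T, ∀ s ∈ Icc a b, ε ≤ ρ t s →
      |r2 t s / (1 + r1 t s ^ 2)| * (ρ t s - ε) ≤ C := by
  obtain ⟨B, B', CB, hB, hB', hCB⟩ := hR.exists_barrier hn hab ht₀
  obtain ⟨Cu, hCu⟩ := hR.exists_gradient_bound hn hab ht₀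
  obtain ⟨R, hR0, hRle⟩ := hR.exists_radius_bound hn hab ht₀
  obtain ⟨m, hm⟩ := isCompact_Icc.exists_bound_of_continuousOn (hR.contS2 ht₀)
  have hmem : ∀ t ∈ Ico t₀ T, t ∈ Ioo 0 T := fun t ht => ⟨ht₀.1.trans_le ht.1, ht.2⟩
  -- The bound for ρ v gives v ≤ Cu/ε where ρ ≥ ε; the summand 1 ensures κ ≥ 1.
  set κ := (Cu / ε) ^ 2 + 1 with hκ
  have hκ1 : 1 ≤ κ := by rw [hκ]; nlinarith [sq_nonneg (Cu / ε)]
  have hVle : ∀ t ∈ Ico t₀ T, ∀ s ∈ Icc a b, ε ≤ ρ t s → 1 + r1 t s ^ 2 ≤ κ := by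
    intro t ht s hs hle
    have h1 := hCu t ht s hs
    have hv := sqrt_one_add_sq_pos (r1 t s)
    have h2 : √(1 + r1 t s ^ 2) ≤ Cu / ε := by
      rw [le_div_iff₀ hε]
      calc √(1 + r1 t s ^ 2) * ε ≤ √(1 + r1 t s ^ 2) * ρ t s := by gcongr
        _ ≤ Cu := by rw [mul_comm]; exact h1
    rw [← sq_sqrt_one_add_sq, hκ]
    have := pow_le_pow_left₀ hv.le h2 2
    linarith
  have hE : ∀ t ∈ Ico t₀ T, ∀ s ∈ Icc a b, ε ≤ ρ t s → κ ≤ 2 * κ - r1 t s ^ 2 := by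
    intro t ht s hs hle
    have := hVle t ht s hs hle
    linarith
  set M := 1 + 12 * κ ^ 2 + 8 * (n - 1) * κ ^ 2 * R ^ 2 / ε ^ 2 with hM
  have hM0 : 0 ≤ M := by
    have : (0 : ℝ) ≤ n - 1 := by
      have : (2 : ℝ) ≤ n := by exact_mod_cast hn
      linarith
    positivity
  -- Twice the constant 4κ⁴ of the growth estimate, since (G²)_t = 2 G G_t.
  set c := 8 * κ ^ 4 with hc
  have hc0 : 0 < c := by positivity
  set G := fun t s => r2 t s / (1 + r1 t s ^ 2) * (ρ t s - ε) / (2 * κ - r1 t s ^ 2) with hG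
  set F := fun t s => G t s ^ 2 * Real.exp (-c * B t) with hF
  -- M² covers the points where G is below the threshold, (mR)² those at time t₀, and the
  -- exponential bounds the weight.
  set L := (M ^ 2 + (m * R) ^ 2) * Real.exp (c * CB) with hL
  have hexp : ∀ t ∈ Ico t₀ T, Real.exp (-c * B t) ≤ Real.exp (c * CB) := fun t ht => by
    refine Real.exp_le_exp.2 ?_
    have := abs_le.1 (hCB t ht)
    nlinarith
  have key : ∀ t' ∈ Ico t₀ T, ∀ s' ∈ Icc a b, ε ≤ ρ t' s' → F t' s' ≤ L := by
    intro t' ht' s' hs' hε'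
    have hsub : Icc t₀ t' ×ˢ Icc a b ⊆ dom a b T := fun z hz =>
      ⟨hmem z.1 ⟨hz.1.1, hz.1.2.trans_lt ht'.2⟩, hz.2⟩
    have hc0 := hR.cont0.mono hsub
    have hc1 := hR.cont1.mono hsub
    have hc2 := hR.cont2.mono hsub
    have hBc : ContinuousOn (fun z : ℝ × ℝ => B z.1) (Icc t₀ t' ×ˢ Icc a b) :=
      ContinuousOn.comp (t := Ioo 0 T)
        (fun t ht => (hB t ht).continuousAt.continuousWithinAt) continuous_fst.continuousOn
        (fun z hz => (hsub hz).1)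
    have hFc : ContinuousOn (fun z : ℝ × ℝ => F z.1 z.2)
        {z | z ∈ Icc t₀ t' ×ˢ Icc a b ∧ 0 ≤ ρ z.1 z.2 - ε} := by
      have hX : {z : ℝ × ℝ | z ∈ Icc t₀ t' ×ˢ Icc a b ∧ 0 ≤ ρ z.1 z.2 - ε} ⊆
        Icc t₀ t' ×ˢ Icc a b := fun z hz => hz.1
      have hc0 := hc0.mono hX
      have hc1 := hc1.mono hX
      have hc2 := hc2.mono hX
      have hBc := hBc.mono hX
      have hne1 : ∀ z ∈ {z : ℝ × ℝ | z ∈ Icc t₀ t' ×ˢ Icc a b ∧ 0 ≤ ρ z.1 z.2 - ε},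
        1 + r1 z.1 z.2 ^ 2 ≠ 0 := fun z _ => by positivity
      have hne2 : ∀ z ∈ {z : ℝ × ℝ | z ∈ Icc t₀ t' ×ˢ Icc a b ∧ 0 ≤ ρ z.1 z.2 - ε},
        2 * κ - r1 z.1 z.2 ^ 2 ≠ 0 := fun z hz => by
          have := hE z.1 ⟨hz.1.1.1, hz.1.1.2.trans_lt ht'.2⟩ z.2 hz.1.2 (by linarith [hz.2])
          linarith
      have h1 : ContinuousOn (fun z : ℝ × ℝ => G z.1 z.2)
        {z : ℝ × ℝ | z ∈ Icc t₀ t' ×ˢ Icc a b ∧ 0 ≤ ρ z.1 z.2 - ε} :=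
          ((hc2.div (by fun_prop) hne1).mul (by fun_prop)).div (by fun_prop) hne2
      exact (h1.pow 2).mul (Real.continuous_exp.comp_continuousOn (continuousOn_const.mul hBc))
    obtain ⟨t, ht, s, hs, hct, hle, hcond⟩ := exists_maximum_point
      (f := F) (c := fun t s => ρ t s - ε) (hc0.sub continuousOn_const) hFc
      (right_mem_Icc.2 ht'.1) hs' (sub_nonneg.2 hε')
    refine hle.trans ?_
    have htT : t ∈ Ico t₀ T := ⟨ht.1, ht.2.trans_lt ht'.2⟩
    have ht0 := hmem t htT
    have hEs := hE t htT s hs (sub_nonneg.1 hct)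
    by_cases hsmall : G t s ^ 2 ≤ M ^ 2 + (m * R) ^ 2
    · exact mul_le_mul hsmall (hexp t htT) (Real.exp_pos _).le (by positivity)
    exfalso
    push Not at hsmall
    have hGM : M ≤ |G t s| := by
      refine abs_le_of_sq_le_sq' ?_ (abs_nonneg _) |>.2
      rw [sq_abs]; nlinarith [sq_nonneg (m * R)]
    have hρ : ε < ρ t s := by
      refine lt_of_le_of_ne (sub_nonneg.1 hct) fun h0 => ?_
      have : G t s = 0 := by simp [hG, h0]
      rw [this] at hsmall
      nlinarith [sq_nonneg M, sq_nonneg (m * R)]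
    have hlt : t₀ < t := by
      refine lt_of_le_of_ne ht.1 fun h0 => ?_
      have h1 : |G t s| ≤ m * R := by
        have h2 := hm s hs
        rw [Real.norm_eq_abs, h0] at h2
        have h3 := hRle t htT s hs
        have hV : 1 ≤ 1 + r1 t s ^ 2 := by nlinarith [sq_nonneg (r1 t s)]
        rw [hG]
        simp only
        rw [abs_div, abs_mul, abs_div, abs_of_pos (by linarith : 0 < 2 * κ - r1 t s ^ 2),
          abs_of_pos (by linarith : 0 < 1 + r1 t s ^ 2), abs_of_pos (sub_pos.2 hρ)]
        refine (div_le_self ?_ (by linarith)).trans ?_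
        · have := (sub_pos.2 hρ).le
          positivity
        · refine mul_le_mul ((div_le_self (abs_nonneg _) hV).trans h2) (by linarith)
            (sub_pos.2 hρ).le ((abs_nonneg _).trans h2)
      have h2 : G t s ^ 2 ≤ (m * R) ^ 2 := by
        rw [← sq_abs]; exact pow_le_pow_left₀ (abs_nonneg _) h1 2
      nlinarith [sq_nonneg M]
    obtain ⟨hloc, hpast⟩ := hcond hlt (sub_pos.2 hρ)
    have hgrow := hR.curvature_growth_le hn hab ht0 hs hε (Real.exp_pos (-c * B t))
      (hVle t htT) (hRle t htT s hs) hρ hloc hGM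
    have hdt := ((hR.hasDerivAt_G (ε := ε) ht0 hs
      (by linarith : 2 * κ - r1 t s ^ 2 ≠ 0)).fun_pow 2).fun_mul
      ((hB t ht0).const_mul (-c)).exp
    have hnn := deriv_nonneg_of_eventually_le_left hdt hpast
    simp only [Nat.cast_ofNat, Nat.add_one_sub_one, pow_one] at hnn
    change 0 ≤ 2 * G t s * _ * _ + G t s ^ 2 * _ at hnn
    change G t s * _ ≤ _ * G t s ^ 2 at hgrow
    have hBt := hB' t htT
    have hG2 : 0 < G t s ^ 2 := lt_of_le_of_lt (by positivity) hsmall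
    generalize (((rt2 t s / (1 + r1 t s ^ 2) -
      2 * r1 t s * (r2 t s / (1 + r1 t s ^ 2)) * rt1 t s / (1 + r1 t s ^ 2)) * (ρ t s - ε) +
      r2 t s / (1 + r1 t s ^ 2) * rt t s +
      r2 t s / (1 + r1 t s ^ 2) * (ρ t s - ε) / (2 * κ - r1 t s ^ 2) *
        (2 * r1 t s * rt1 t s)) / (2 * κ - r1 t s ^ 2)) = Gt at hnn hgrow
    have he := Real.exp_pos (-c * B t)
    have hnn2 : 0 ≤ (2 * (G t s * Gt) - c * (B' t * G t s ^ 2)) * Real.exp (-c * B t) := by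
      refine hnn.trans_eq ?_
      ring
    have hnn3 := nonneg_of_mul_nonneg_left hnn2 he
    have h1 : c * ((h t ^ 2 + 1) * G t s ^ 2) ≤ c * (B' t * G t s ^ 2) := by gcongr
    have h2 : 2 * (4 * κ ^ 4 * h t ^ 2 * G t s ^ 2) = c * (h t ^ 2 * G t s ^ 2) := by
      rw [hc]; ring
    have h3 : 0 < c * G t s ^ 2 := by positivity
    linarith
  -- The exponential removes the weight, and 2κ bounds the denominator of G.
  refine ⟨√(L * Real.exp (c * CB)) * (2 * κ), fun t ht s hs hle => ?_⟩
  have h1 := key t ht s hs hle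
  have h2 : G t s ^ 2 ≤ L * Real.exp (c * CB) := by
    have h3 : Real.exp (-(c * CB)) ≤ Real.exp (-c * B t) := by
      refine Real.exp_le_exp.2 ?_
      have := abs_le.1 (hCB t ht)
      nlinarith
    have h4 : G t s ^ 2 * Real.exp (-(c * CB)) ≤ L :=
      (mul_le_mul_of_nonneg_left h3 (sq_nonneg _)).trans h1
    rw [Real.exp_neg] at h4
    rwa [← div_eq_mul_inv, div_le_iff₀ (Real.exp_pos _)] at h4
  have h3 := Real.abs_le_sqrt h2
  have hEs := hE t ht s hs hle
  have hEp : 0 < 2 * κ - r1 t s ^ 2 := by linarith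
  have h4 : |r2 t s / (1 + r1 t s ^ 2)| * (ρ t s - ε) = |G t s| * (2 * κ - r1 t s ^ 2) := by
    rw [hG]
    simp only
    generalize r2 t s / (1 + r1 t s ^ 2) = Q
    rw [abs_div, abs_mul, abs_of_pos hEp, abs_of_nonneg (sub_nonneg.2 hle),
      div_mul_cancel₀ _ hEp.ne']
  rw [h4]
  exact mul_le_mul h3 (by linarith [sq_nonneg (r1 t s)]) hEp.le (Real.sqrt_nonneg _)

/-- Away from the axis of rotation the curvature of the profile curve stays bounded. -/
theorem exists_curvature_bound (hR : RadialFlow n a b T ρ r1 r2 r3 r4 rt rt1 rt2 h)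
    (hn : 2 ≤ n) (hab : a < b) {t₀ ε : ℝ} (ht₀ : t₀ ∈ Ioo 0 T) (hε : 0 < ε) :
    ∃ C, ∀ t ∈ Ico t₀ T, ∀ s ∈ Icc a b, ε ≤ ρ t s → |r2 t s / (1 + r1 t s ^ 2)| ≤ C := by
  -- With cutoff level ε/2 the factor ρ - ε/2 is at least ε/2 on {ρ ≥ ε} and can be divided out.
  obtain ⟨C, hC⟩ := hR.exists_cutoff_curvature_bound hn hab ht₀ (half_pos hε)
  refine ⟨C / (ε / 2), fun t ht s hs hle => ?_⟩
  rw [le_div_iff₀ (half_pos hε)]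
  refine le_trans ?_ (hC t ht s hs (by linarith))
  gcongr
  linarith

end RadialFlow

/-! ### Bound for |A| and conclusion -/

theorem normA_le {n : ℕ} {a b : ℝ} {r : ℝ → ℝ} {z : Amb n} {q ε C : ℝ} (hn : 2 ≤ n) (hab : a < b)
    (hz : z ∈ revSurface n a b r) (hε : 0 < ε) (hh : ε ≤ height z)
    (hq : HasDerivWithinAt (slope a b r) q (Icc a b) (z 0))
    (hC : |q / (1 + slope a b r (z 0) ^ 2)| ≤ C) :
    normA a b r z ≤ √(C ^ 2 + (n - 1) * (1 / ε) ^ 2) := by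
  rw [normA_eq hab hz.1 (hε.trans_le hh) hq]
  have hv1 := one_le_sqrt_one_add_sq (slope a b r (z 0))
  have hv2 := sq_sqrt_one_add_sq (slope a b r (z 0))
  rw [← hv2] at hC
  generalize √(1 + slope a b r (z 0) ^ 2) = v at *
  have hv0 : 0 < v := by linarith
  have hn1 : (0 : ℝ) ≤ n - 1 := by
    have : (2 : ℝ) ≤ n := by exact_mod_cast hn
    linarith
  have h1 : |q / v ^ 3| ≤ C := by
    refine le_trans ?_ hC
    rw [abs_div, abs_div, abs_of_pos (by positivity : 0 < v ^ 3),
      abs_of_pos (by positivity : 0 < v ^ 2)]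
    exact div_le_div_of_nonneg_left (abs_nonneg _) (by positivity)
      (pow_le_pow_right₀ hv1 (by norm_num))
  have h2 : (q / v ^ 3) ^ 2 ≤ C ^ 2 := by
    rw [← sq_abs]; exact pow_le_pow_left₀ (abs_nonneg _) h1 2
  have h3 : 1 / (height z * v) ≤ 1 / ε :=
    one_div_le_one_div_of_le hε (hh.trans (le_mul_of_one_le_right (hε.le.trans hh) hv1))
  have h4 : 0 ≤ 1 / (height z * v) := by
    have := hε.trans_le hh
    positivity
  gcongr

/-- The maximum principle needs joint smoothness and hence a positive starting time, here T/2. On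
[0, T/2] the second derivative is continuous on a compact set and therefore bounded. -/
theorem IsFlow.exists_normA_bound {n : ℕ} {a b T : ℝ} {ρ : ℝ → ℝ → ℝ} {x : Amb n → ℝ → Amb n}
    (hflow : IsFlow n a b T ρ x) (hn : 2 ≤ n) (hab : a < b) (hT : 0 < T) {ε : ℝ} (hε : 0 < ε) :
    ∃ C : ℝ, ∀ t ∈ Ico 0 T, ∀ z ∈ revSurface n a b (ρ t), ε ≤ height z →
      normA a b (ρ t) z ≤ C := by
  obtain ⟨r1, r2, r3, r4, rt, rt1, rt2, h, hR⟩ := hflow.exists_radialFlow hn hab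
  have ht₀ : T / 2 ∈ Ioo 0 T := ⟨by linarith, by linarith⟩
  obtain ⟨C₁, hC₁⟩ := hR.exists_curvature_bound hn hab ht₀ hε
  have hK : IsCompact (Icc 0 (T / 2) ×ˢ Icc a b) := isCompact_Icc.prod isCompact_Icc
  obtain ⟨C₂, hC₂⟩ := hK.exists_bound_of_continuousOn
    ((hflow.continuous_initial 2 le_rfl).mono
      (prod_mono (fun t ht => ⟨ht.1, by linarith [ht.2]⟩) le_rfl))
  refine ⟨max (√(C₁ ^ 2 + (n - 1) * (1 / ε) ^ 2)) (√(C₂ ^ 2 + (n - 1) * (1 / ε) ^ 2)),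
    fun t ht z hz hh => ?_⟩
  rcases le_or_gt t (T / 2) with hle | hgt
  · refine le_max_of_le_right ?_
    have hU := uniqueDiffOn_Icc hab
    have hd : DifferentiableWithinAt ℝ (slope a b (ρ t)) (Icc a b) (z 0) :=
      ((hflow.smooth_space t ht).derivWithin hU (m := ∞) (by simp)).differentiableOn
        (by simp) (z 0) hz.1
    have he : derivWithin (slope a b (ρ t)) (Icc a b) (z 0) =
        iteratedDerivWithin 2 (ρ t) (Icc a b) (z 0) := by
      rw [iteratedDerivWithin_succ]
      exact derivWithin_congr (fun s _ => by rw [iteratedDerivWithin_one]; rfl)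
        (by rw [iteratedDerivWithin_one]; rfl)
    have hq := hd.hasDerivWithinAt
    rw [he] at hq
    refine normA_le hn hab hz hε hh hq ?_
    have hb := hC₂ (t, z 0) ⟨⟨ht.1, hle⟩, hz.1⟩
    rw [Real.norm_eq_abs] at hb
    refine le_trans ?_ hb
    have hV : 1 ≤ 1 + slope a b (ρ t) (z 0) ^ 2 := by linarith [sq_nonneg (slope a b (ρ t) (z 0))]
    rw [abs_div, abs_of_pos (by linarith : 0 < 1 + slope a b (ρ t) (z 0) ^ 2)]
    exact div_le_self (abs_nonneg _) hV
  · refine le_max_of_le_left ?_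
    have ht' : t ∈ Ioo 0 T := ⟨ht₀.1.trans hgt, ht.2⟩
    refine normA_le hn hab hz hε hh
      (hasDerivWithinAt_slope hab (hR.ds0 t ht') hz.1 (hR.ds1 t ht' _ hz.1)) ?_
    rw [slope_eq_of_hasDerivWithinAt hab hz.1 (hR.ds0 t ht' _ hz.1)]
    exact hC₁ t ⟨hgt.le, ht.2⟩ _ hz.1 (hz.2 ▸ hh)

end AxialVPMCF

theorem proposition5p6 (n : ℕ) (hn : 2 ≤ n) (a b T : ℝ) (hab : a < b) (hT : 0 < T)
    (ρ : ℝ → ℝ → ℝ) (x : AxialVPMCF.Amb n → ℝ → AxialVPMCF.Amb n)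
    (hflow : AxialVPMCF.IsFlow n a b T ρ x) :
    (∀ ε : ℝ, 0 < ε → ∀ S : ℝ → Set (AxialVPMCF.Amb n),
      (∀ t ∈ Set.Ico 0 T, S t ⊆ AxialVPMCF.revSurface n a b (ρ t)) →
      (∀ t ∈ Set.Ico 0 T, ∀ z ∈ S t, ε ≤ AxialVPMCF.height z) →
      ∃ C : ℝ, ∀ t ∈ Set.Ico 0 T, ∀ z ∈ S t, AxialVPMCF.normA a b (ρ t) z ≤ C) ∧
    (∀ p : AxialVPMCF.Amb n,
      AxialVPMCF.IsSingularPoint n a b T ρ p → p ∈ AxialVPMCF.rotationAxis n) := by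
  refine ⟨fun ε hε S hS hy => ?_, ?_⟩
  · obtain ⟨C, hC⟩ := hflow.exists_normA_bound hn hab hT hε
    exact ⟨C, fun t ht z hz => hC t ht z (hS t ht hz) (hy t ht z hz)⟩
  · rintro p ⟨τ, z, hτ, -, hz, hzp, hA⟩
    by_contra hp
    have hpos : 0 < AxialVPMCF.height p := by
      rw [AxialVPMCF.height_eq_norm_hat]
      exact norm_pos_iff.2 hp
    -- Half the height of p is a lower bound for the heights of the z_j eventually, by continuity of
    -- the height.
    obtain ⟨C, hC⟩ := hflow.exists_normA_bound hn hab hT (half_pos hpos)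
    have h1 : ∀ᶠ j in atTop, AxialVPMCF.height p / 2 < AxialVPMCF.height (z j) :=
      (AxialVPMCF.continuous_height.continuousAt.tendsto.comp hzp).eventually
        (lt_mem_nhds (half_lt_self hpos))
    obtain ⟨j, hj1, hj2⟩ := (h1.and (hA.eventually_gt_atTop C)).exists
    exact (hC (τ j) (hτ j) (z j) (hz j) hj1.le).not_gt hj2
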